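/- Let $R=\mathbb R[[t]]$, $\mathfrak m=(t)$, and write $\bar p=p(0)$ for $p\in R$. The real Gelfand order is the $\mathbb R$-algebra $$A=\left\{(a_{ij})\in M_3(R)\;\middle|\;\bar a_{13}=\bar a_{23}=0,\ \bar a_{11}=\bar a_{22},\ \bar a_{21}=-\bar a_{12}\right\}.$$ Let $e=\mathrm{diag}(1,1,0)$ and $f=\mathrm{diag}(0,0,1)$ in $A$. Let $S$ be the simple $A$-module $\mathbb C$ on which $a$ acts as $\bar a_{11}+i\,\bar a_{21}$, and $T$ the simple $A$-module $\mathbb R$ on which $a$ acts as $\bar a_{33}$. The dimension vector of a finite dimensional $A$-module $M$ is $\left(\tfrac12\dim_{\mathbb R}eM,\ \dim_{\mathbb R}fM\right)$. The top of $M$ is $M/\mathrm{rad}(M)$, where $\mathrm{rad}(M)$ is the intersection of the maximal submodules of $M$; a finite dimensional $A$-module is absolutely cyclic if its top is simple. Consider the $A$-lattices $$P=Ae=\left\{x\in \mathrm{Mat}_{3\times 2}(R)\;\middle|\;\bar x_{11}=\bar x_{22},\ \bar x_{21}=-\bar x_{12}\right\},\qquad Q=Af=\begin{bmatrix}\mathfrak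 m\\ \mathfrak m\\ R\end{bmatrix},\qquad L=\begin{bmatrix}R\\R\\R\end{bmatrix},$$ on which $A$ acts by left multiplication. View a direct sum of two of the lattices $Q,L$ as a set of $3\times2$ matrices, the summands being the columns; a matrix over $R$ written on an arrow denotes right multiplication by it. Let $\mathbb N=\{1,2,\dots\}$ and $\mathbb N_0=\mathbb N\cup\{0\}$. The top of every absolutely cyclic $A$-module is isomorphic to $T$ or to $S$. Let $M$ be an absolutely cyclic $A$-module. (I) If the top of $M$ is isomorphic to $T$, then $M$ is isomorphic to the cokernel of exactly one of the following maps, in particular for a uniquely determined $k$: (a) $Q\xrightarrow{t^k}Q$ with $k\in\mathbb N$; the dimension vector is $(k,k)$. (b) $L\xrightarrow{t^k}Q$ with $k\in\mathbb N$; the dimension vector is $(k-1,k)$. (II) If the top of $M$ is isomorphic to $S$, then $M$ is isomorphic to the cokernel of one of the following maps. The type of the map (where the two maps in (c) count as two types) and the parameters $k$ and $l$ are uniquely determined by $M$. (a) $Q\oplus Q\xrightarrow{t^k\left(\begin{smallmatrix}1&0\\0&t^l\end{smallmatrix}\right)}P$ with $k,l\in\mathbb N_0$; the dimension vector is $(2k+l+1,2k+l)$.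 (b) $L\oplus L\xrightarrow{t^k\left(\begin{smallmatrix}1&0\\0&t^l\end{smallmatrix}\right)}P$ with $k\in\mathbb N$, $l\in\mathbb N_0$; the dimension vector is $(2k+l-1,2k+l)$. (c) $L\oplus Q\xrightarrow{t^k\left(\begin{smallmatrix}1&0\\0&t^l\end{smallmatrix}\right)}P$ with $k\in\mathbb N$, $l\in\mathbb N_0$, or $L\oplus Q\xrightarrow{t^k\left(\begin{smallmatrix}t^l&0\\0&1\end{smallmatrix}\right)}P$ with $k\in\mathbb N_0$, $l\in\mathbb N$; in both cases the dimension vector is $(2k+l,2k+l)$. (d) $P\xrightarrow{t^k\left(\begin{smallmatrix}1&0\\0&\lambda t^l\end{smallmatrix}\right)}P$ with $k\in\mathbb N$, $l\in\mathbb N_0$, $\lambda\in\mathbb R^*$; the dimension vector is $(2k+l,2k+l)$. Two such cokernels with parameters $(k,l,\lambda)$ and $(k',l',\lambda')$ are isomorphic if and only if $k=k'$, $l=l'$ and either $\lambda'=\lambda$, or $l=0$ and $\lambda'=\lambda^{-1}$. Hence $\lambda$ is unique if $l\ge1$, and it is unique if one requires $\lambda\in[-1,1]\setminus\{0\}$ when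 $l=0$. Conversely, every cokernel listed in (I) is absolutely cyclic with top isomorphic to $T$, and every cokernel listed in (II) is absolutely cyclic with top isomorphic to $S$. -/

import Mathlib

noncomputable section

open PowerSeries

namespace RealGelfand

/-- `R = ℝ⟦t⟧`; its maximal ideal `𝔪 = (t)` is the set of `p` with `constantCoeff p = 0`. -/
abbrev R : Type := PowerSeries ℝ

/-- The variable `t` of `R`. -/
abbrev t : R := PowerSeries.X

/-- The value `p(0)` of a power series. -/
abbrev ev (p : R) : ℝ := PowerSeries.constantCoeff p

/-- The real Gelfand order, with rows and columns numbered `0, 1, 2`: the `3 × 3` matrices over `R`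
with entries `(0,2)` and `(1,2)` in `𝔪` whose upper left `2 × 2` block is, modulo `𝔪`, of the form
`(α, -β; β, α)`. -/
def gelfandOrder : Subalgebra ℝ (Matrix (Fin 3) (Fin 3) R) where
  carrier := {a | ev (a 0 2) = 0 ∧ ev (a 1 2) = 0 ∧
    ev (a 0 0) = ev (a 1 1) ∧ ev (a 1 0) = - ev (a 0 1)}
  mul_mem' := by
    rintro a b ⟨ha1, ha2, ha3, ha4⟩ ⟨hb1, hb2, hb3, hb4⟩
    simp only [ev] at *
    refine ⟨?_, ?_, ?_, ?_⟩ <;>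
      simp [Matrix.mul_apply, Fin.sum_univ_three, ha1, ha2, ha3, ha4, hb1, hb2, hb3, hb4] <;> ring
  add_mem' := by
    rintro a b ⟨ha1, ha2, ha3, ha4⟩ ⟨hb1, hb2, hb3, hb4⟩
    simp only [ev] at *
    refine ⟨?_, ?_, ?_, ?_⟩ <;> simp [ha1, ha2, ha3, ha4, hb1, hb2, hb3, hb4] <;> ring
  algebraMap_mem' := by
    intro r
    refine ⟨?_, ?_, ?_, ?_⟩ <;> simp [ev, Matrix.algebraMap_matrix_apply]

/-- The real Gelfand order as a type. -/
def A : Type := gelfandOrder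

instance : Ring A := inferInstanceAs (Ring gelfandOrder)
instance : Algebra ℝ A := inferInstanceAs (Algebra ℝ gelfandOrder)

/-- The matrix of an element of `A`. -/
def mat (a : A) : Matrix (Fin 3) (Fin 3) R := Subtype.val (p := (· ∈ gelfandOrder)) a

theorem mat_mem (a : A) : ev (mat a 0 2) = 0 ∧ ev (mat a 1 2) = 0 ∧
    ev (mat a 0 0) = ev (mat a 1 1) ∧ ev (mat a 1 0) = - ev (mat a 0 1) :=
  Subtype.property (p := (· ∈ gelfandOrder)) a

theorem mat_one : mat 1 = 1 := rfl

theorem mat_zero : mat 0 = 0 := rfl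

theorem mat_add (a b : A) : mat (a + b) = mat a + mat b := rfl

theorem mat_mul (a b : A) : mat (a * b) = mat a * mat b := rfl

theorem mat_smul (r : ℝ) (a : A) : mat (r • a) = r • mat a := rfl

/-- The idempotent `e = diag(1, 1, 0)` of `A`. -/
def e : A := ⟨!![1, 0, 0; 0, 1, 0; 0, 0, 0], by
  refine ⟨?_, ?_, ?_, ?_⟩ <;> simp [ev]⟩

/-- The idempotent `f = diag(0, 0, 1)` of `A`. -/
def f : A := ⟨!![0, 0, 0; 0, 0, 0; 0, 0, 1], by
  refine ⟨?_, ?_, ?_, ?_⟩ <;> simp [ev]⟩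

/-! ### The two simple modules -/

/-- The ring homomorphism `A → ℂ`, `a ↦ α + iβ`, where `(α, -β; β, α)` is the upper left block
of `a` modulo `𝔪`. -/
def toC : A →+* ℂ where
  toFun a := ⟨ev (mat a 0 0), ev (mat a 1 0)⟩
  map_one' := by apply Complex.ext <;> simp [ev, mat_one]
  map_zero' := by apply Complex.ext <;> simp [ev, mat_zero]
  map_add' a b := by apply Complex.ext <;> simp [ev, mat_add]
  map_mul' := by
    intro a b
    obtain ⟨ha1, ha2, ha3, ha4⟩ := mat_mem a
    simp only [ev] at *
    apply Complex.ext
    · simp [mat_mul, Matrix.mul_apply, Fin.sum_univ_three, ha1, ha4]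
    · simp [mat_mul, Matrix.mul_apply, Fin.sum_univ_three, ha2, ha3]; ring

/-- The ring homomorphism `A → ℝ`, the lower right entry modulo `𝔪`. -/
def toR : A →+* ℝ where
  toFun a := ev (mat a 2 2)
  map_one' := by simp [ev, mat_one]
  map_zero' := by simp [ev, mat_zero]
  map_add' a b := by simp [ev, mat_add]
  map_mul' := by
    intro a b
    obtain ⟨hb1, hb2, hb3, hb4⟩ := mat_mem b
    simp only [ev] at *
    simp [mat_mul, Matrix.mul_apply, Fin.sum_univ_three, hb1, hb2]

/-- The simple module `S`, of dimension vector `(1, 0)`: the field `ℂ` with `A` acting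
through `A → ℂ`. -/
def S : Type := ℂ

instance : AddCommGroup S := inferInstanceAs (AddCommGroup ℂ)
instance : Module A S := Module.compHom ℂ toC

/-- The simple module `T`, of dimension vector `(0, 1)`: the field `ℝ` with `A` acting
through `A → ℝ`. -/
def T : Type := ℝ

instance : AddCommGroup T := inferInstanceAs (AddCommGroup ℝ)
instance : Module A T := Module.compHom ℝ toR

/-! ### Tops, absolutely cyclic modules, dimension vectors -/

/-- The top `M / rad M` of an `A`-module. -/
abbrev TopOf (M : Type*) [AddCommGroup M] [Module A M] : Type _ := M ⧸ Module.jacobson A M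

/-- `M` is an absolutely cyclic object of the category of finite dimensional `A`-modules:
it is finite dimensional and its top is simple. -/
structure IsAbsolutelyCyclic (M : Type*) [AddCommGroup M] [Module ℝ M] [Module A M]
    [IsScalarTower ℝ A M] : Prop where
  finite : Module.Finite ℝ M
  simple_top : IsSimpleModule A (TopOf M)

/-- `M` has dimension vector `d = (dim U, dim V)`, where `V = f M` and `e M ≅ U ⊕ U` as a
vector space over `ℝ` with complex structure, so that `dim_ℝ (e M) = 2 dim U`. -/
structure HasDimVector (M : Type*) [AddCommGroup M] [Module ℝ M] [Module A M]
    [IsScalarTower ℝ A M] (d : ℕ × ℕ) : Prop where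
  finite : Module.Finite ℝ M
  dim_e : Module.finrank ℝ (LinearMap.range (Algebra.lsmul ℝ ℝ M e)) = 2 * d.1
  dim_f : Module.finrank ℝ (LinearMap.range (Algebra.lsmul ℝ ℝ M f)) = d.2

/-! ### Lattices and their homomorphisms -/

/-- `3 × n` matrices over `R`, on which `A` acts by left multiplication. -/
def Mat (n : ℕ) : Type := Matrix (Fin 3) (Fin n) R

instance (n : ℕ) : AddCommGroup (Mat n) :=
  inferInstanceAs (AddCommGroup (Matrix (Fin 3) (Fin n) R))
instance (n : ℕ) : Module ℝ (Mat n) := inferInstanceAs (Module ℝ (Matrix (Fin 3) (Fin n) R))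

instance (n : ℕ) : Module A (Mat n) where
  smul a x := (mat a * (show Matrix (Fin 3) (Fin n) R from x) : Matrix (Fin 3) (Fin n) R)
  one_smul x := Matrix.one_mul (show Matrix (Fin 3) (Fin n) R from x)
  mul_smul a b x := Matrix.mul_assoc (mat a) (mat b) (show Matrix (Fin 3) (Fin n) R from x)
  smul_zero a := Matrix.mul_zero (mat a)
  smul_add a _ _ := Matrix.mul_add (mat a) _ _
  add_smul a b x := Matrix.add_mul (mat a) (mat b) (show Matrix (Fin 3) (Fin n) R from x)
  zero_smul x := Matrix.zero_mul (show Matrix (Fin 3) (Fin n) R from x)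

instance (n : ℕ) : IsScalarTower ℝ A (Mat n) where
  smul_assoc r a x := Matrix.smul_mul r (mat a) (show Matrix (Fin 3) (Fin n) R from x)

theorem smul_entry {n : ℕ} (a : A) (x : Mat n) (i : Fin 3) (j : Fin n) :
    (a • x) i j = mat a i 0 * x 0 j + mat a i 1 * x 1 j + mat a i 2 * x 2 j := by
  change ((mat a * (show Matrix (Fin 3) (Fin n) R from x) : Matrix (Fin 3) (Fin n) R)) i j = _
  rw [Matrix.mul_apply, Fin.sum_univ_three]

theorem add_entry {n : ℕ} (x y : Mat n) (i : Fin 3) (j : Fin n) :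
    (x + y) i j = x i j + y i j := rfl

theorem zero_entry {n : ℕ} (i : Fin 3) (j : Fin n) : (0 : Mat n) i j = 0 := rfl

/-- The lattice `L = [R; R; R]`. -/
def L : Submodule A (Mat 1) := ⊤

/-- The lattice `Q = A f = [𝔪; 𝔪; R]`. -/
def Q : Submodule A (Mat 1) where
  carrier := {x | ev (x 0 0) = 0 ∧ ev (x 1 0) = 0}
  zero_mem' := by constructor <;> simp [ev, zero_entry]
  add_mem' := by
    rintro x y ⟨hx1, hx2⟩ ⟨hy1, hy2⟩
    simp only [ev] at *
    constructor <;> simp [add_entry, hx1, hx2, hy1, hy2]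
  smul_mem' := by
    rintro a x ⟨hx1, hx2⟩
    obtain ⟨ha1, ha2, ha3, ha4⟩ := mat_mem a
    simp only [ev] at *
    constructor <;> simp [smul_entry, hx1, hx2, ha1, ha2]

/-- The lattice `P = A e`: the `3 × 2` matrices whose upper `2 × 2` block is, modulo `𝔪`, of the
form `(α, -β; β, α)`, with no condition on the last row. -/
def P : Submodule A (Mat 2) where
  carrier := {x | ev (x 0 0) = ev (x 1 1) ∧ ev (x 1 0) = - ev (x 0 1)}
  zero_mem' := by constructor <;> simp [ev, zero_entry]
  add_mem' := by
    rintro x y ⟨hx1, hx2⟩ ⟨hy1, hy2⟩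
    simp only [ev] at *
    constructor <;> simp [add_entry, hx1, hx2, hy1, hy2]; ring
  smul_mem' := by
    rintro a x ⟨hx1, hx2⟩
    obtain ⟨ha1, ha2, ha3, ha4⟩ := mat_mem a
    simp only [ev] at *
    constructor <;> simp [smul_entry, hx1, hx2, ha1, ha2, ha3, ha4]; ring

/-- The `j`-th column of a matrix, as a homomorphism of `A`-modules. -/
def col {n : ℕ} (j : Fin n) : Mat n →ₗ[A] Mat 1 where
  toFun x := fun i _ => x i j
  map_add' _ _ := rfl
  map_smul' a x := by
    funext i k
    exact (smul_entry a x i j).trans (smul_entry a (fun i _ => x i j : Mat 1) i k).symm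

/-- `F ⊕ G` for submodules `F, G` of `Mat 1`, realised as the `3 × 2` matrices with first column
in `F` and second column in `G`. -/
def dsum (F G : Submodule A (Mat 1)) : Submodule A (Mat 2) :=
  F.comap (col 0) ⊓ G.comap (col 1)

/-- Right multiplication by an `n × m` matrix, as a homomorphism of `A`-modules. -/
def rmul {n m : ℕ} (Z : Matrix (Fin n) (Fin m) R) : Mat n →ₗ[A] Mat m where
  toFun x := ((show Matrix (Fin 3) (Fin n) R from x) * Z : Matrix (Fin 3) (Fin m) R)
  map_add' x _ := Matrix.add_mul (show Matrix (Fin 3) (Fin n) R from x) _ Z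
  map_smul' a x := Matrix.mul_assoc (mat a) (show Matrix (Fin 3) (Fin n) R from x) Z

theorem rmul_entry {n m : ℕ} (Z : Matrix (Fin n) (Fin m) R) (x : Mat n) (i : Fin 3) (j : Fin m) :
    rmul Z x i j = ∑ s, x i s * Z s j := rfl

/-- The homomorphism `F → F'` given by right multiplication by `Z`. -/
def latticeMap {n m : ℕ} (F : Submodule A (Mat n)) (F' : Submodule A (Mat m))
    (Z : Matrix (Fin n) (Fin m) R) (h : ∀ x ∈ F, rmul Z x ∈ F') : F →ₗ[A] F' :=
  (rmul Z).restrict h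

/-- `t^k : Q → Q`. -/
def mapQQ (k : ℕ) : Q →ₗ[A] Q :=
  latticeMap Q Q !![t ^ k] (by
    rintro x ⟨h1, h2⟩
    simp only [ev] at *
    constructor <;> simp [rmul_entry, h1, h2])

/-- `t^k : L → Q`, for `k ≥ 1`. -/
def mapLQ (k : ℕ) (hk : 1 ≤ k) : L →ₗ[A] Q :=
  latticeMap L Q !![t ^ k] (by
    rintro x -
    have : k ≠ 0 := by omega
    constructor <;> simp [rmul_entry, this])

/-- `t^k · diag(1, t^l) : Q ⊕ Q → P`. -/
def mapQQP (k l : ℕ) : dsum Q Q →ₗ[A] P :=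
  latticeMap (dsum Q Q) P (t ^ k • !![1, 0; 0, t ^ l]) (by
    rintro x ⟨⟨h1, h2⟩, h3, h4⟩
    replace h1 : constantCoeff (x 0 0) = 0 := h1
    replace h2 : constantCoeff (x 1 0) = 0 := h2
    replace h3 : constantCoeff (x 0 1) = 0 := h3
    replace h4 : constantCoeff (x 1 1) = 0 := h4
    constructor <;> simp [rmul_entry, h1, h2, h3, h4])

/-- `t^k · diag(1, t^l) : L ⊕ L → P`, for `k ≥ 1`. -/
def mapLLP (k l : ℕ) (hk : 1 ≤ k) : dsum L L →ₗ[A] P :=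
  latticeMap (dsum L L) P (t ^ k • !![1, 0; 0, t ^ l]) (by
    rintro x -
    have : k ≠ 0 := by omega
    constructor <;> simp [rmul_entry, this])

/-- `t^k · diag(1, t^l) : L ⊕ Q → P`, for `k ≥ 1`. -/
def mapLQP (k l : ℕ) (hk : 1 ≤ k) : dsum L Q →ₗ[A] P :=
  latticeMap (dsum L Q) P (t ^ k • !![1, 0; 0, t ^ l]) (by
    rintro x -
    have : k ≠ 0 := by omega
    constructor <;> simp [rmul_entry, this])

/-- `t^k · diag(t^l, 1) : L ⊕ Q → P`, for `l ≥ 1`. -/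
def mapLQP' (k l : ℕ) (hl : 1 ≤ l) : dsum L Q →ₗ[A] P :=
  latticeMap (dsum L Q) P (t ^ k • !![t ^ l, 0; 0, 1]) (by
    rintro x ⟨-, h3, h4⟩
    have : l ≠ 0 := by omega
    replace h3 : constantCoeff (x 0 1) = 0 := h3
    replace h4 : constantCoeff (x 1 1) = 0 := h4
    constructor <;> simp [rmul_entry, this, h3, h4])

/-- `t^k · diag(1, c t^l) : P → P`, for `k ≥ 1`. -/
def mapPP (k l : ℕ) (c : ℝ) (hk : 1 ≤ k) : P →ₗ[A] P :=
  latticeMap P P (t ^ k • !![1, 0; 0, PowerSeries.C c * t ^ l]) (by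
    rintro x -
    have : k ≠ 0 := by omega
    constructor <;> simp [rmul_entry, this])

/-! ### The parameters of the normal forms -/

/-- The parameters of the maps into `Q`. -/
inductive FormT : Type
  | QQ (k : ℕ) (hk : 1 ≤ k)
  | LQ (k : ℕ) (hk : 1 ≤ k)

namespace FormT

/-- The image of the map with the given parameters. -/
def image : FormT → Submodule A Q
  | QQ k _ => LinearMap.range (mapQQ k)
  | LQ k hk => LinearMap.range (mapLQ k hk)

/-- The cokernel of the map with the given parameters. -/
abbrev Mod (p : FormT) : Type := Q ⧸ p.image

/-- The dimension vector of the cokernel. -/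
def dimVector : FormT → ℕ × ℕ
  | QQ k _ => (k, k)
  | LQ k _ => (k - 1, k)

end FormT

/-- The parameters of the maps into `P`. -/
inductive FormS : Type
  | QQ (k l : ℕ)
  | LL (k l : ℕ) (hk : 1 ≤ k)
  | LQ (k l : ℕ) (hk : 1 ≤ k)
  | LQ' (k l : ℕ) (hl : 1 ≤ l)
  | PP (k l : ℕ) (c : ℝ) (hk : 1 ≤ k) (hc : c ≠ 0)

namespace FormS

/-- The image of the map with the given parameters. -/
def image : FormS → Submodule A P
  | QQ k l => LinearMap.range (mapQQP k l)
  | LL k l hk => LinearMap.range (mapLLP k l hk)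
  | LQ k l hk => LinearMap.range (mapLQP k l hk)
  | LQ' k l hl => LinearMap.range (mapLQP' k l hl)
  | PP k l c hk _ => LinearMap.range (mapPP k l c hk)

/-- The cokernel of the map with the given parameters. -/
abbrev Mod (p : FormS) : Type := P ⧸ p.image

/-- The dimension vector of the cokernel. -/
def dimVector : FormS → ℕ × ℕ
  | QQ k l => (2 * k + l + 1, 2 * k + l)
  | LL k l _ => (2 * k + l - 1, 2 * k + l)
  | LQ k l _ => (2 * k + l, 2 * k + l)
  | LQ' k l _ => (2 * k + l, 2 * k + l)
  | PP k l _ _ _ => (2 * k + l, 2 * k + l)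

/-- The normalisation of the real parameter: it lies in `[-1, 1]` if `l = 0`. -/
def IsNormalized : FormS → Prop
  | PP _ l c _ _ => l = 0 → c ∈ Set.Icc (-1 : ℝ) 1
  | _ => True

end FormS

end RealGelfand

end

/-!
An absolutely cyclic module is a quotient of `Q` or of `P` by a submodule `N` of finite colength.
Such an `N` is determined by its last rows, an `R`-lattice in `Rⁿ`, and by its upper rows, which
lie between `t` times that lattice and the lattice itself. Once the lattice of last rows is
diagonal, the upper rows read as a complex subspace `W` of `ℂⁿ`.

An automorphism of `P` is the right multiplication by an invertible matrix whose constant part is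
of the form `(α, -β; β, α)`, and isomorphisms between quotients of `P` lift to such automorphisms.
They bring the last rows to the form `diag(tᵏ, tᵏ⁺ˡ)`. Then `W = 0` gives `Q ⊕ Q`, `W = ℂ²` gives
`L ⊕ L`, and a line `W` gives `L ⊕ Q`, `Q ⊕ L` or `P`, after normalising the line by the stabiliser
of the diagonal lattice: the rotations if `l = 0`, the triangular shears if `l ≥ 1`.
-/

noncomputable section

open PowerSeries

namespace RealGelfand

/-! ### Elements of the order and their action on matrices -/

@[ext]
theorem A.ext {a b : A} (h : ∀ i j, mat a i j = mat b i j) : a = b :=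
  Subtype.ext (Matrix.ext h)

@[ext]
theorem Mat.ext {n : ℕ} {x y : Mat n} (h : ∀ i j, x i j = y i j) : x = y :=
  Matrix.ext h

theorem real_smul_entry {n : ℕ} (r : ℝ) (x : Mat n) (i : Fin 3) (j : Fin n) :
    (r • x) i j = r • x i j := rfl

theorem mat_e : mat e = !![1, 0, 0; 0, 1, 0; 0, 0, 0] := rfl

theorem mat_f : mat f = !![0, 0, 0; 0, 0, 0; 0, 0, 1] := rfl

theorem e_smul_entry {n : ℕ} (x : Mat n) (i : Fin 3) (j : Fin n) :
    (e • x) i j = if i = 2 then 0 else x i j := by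
  rw [smul_entry, mat_e]
  fin_cases i <;> simp

theorem f_smul_entry {n : ℕ} (x : Mat n) (i : Fin 3) (j : Fin n) :
    (f • x) i j = if i = 2 then x i j else 0 := by
  rw [smul_entry, mat_f]
  fin_cases i <;> simp

theorem e_add_f : e + f = 1 := by
  ext i j : 1
  rw [mat_add, mat_one, mat_e, mat_f]
  fin_cases i <;> fin_cases j <;> simp

theorem e_mul_e : e * e = e := by
  ext i j : 1
  rw [mat_mul, mat_e, Matrix.mul_apply, Fin.sum_univ_three]
  fin_cases i <;> fin_cases j <;> simp

theorem f_mul_f : f * f = f := by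
  ext i j : 1
  rw [mat_mul, mat_f, Matrix.mul_apply, Fin.sum_univ_three]
  fin_cases i <;> fin_cases j <;> simp

/-- The element of `A` whose only nonzero entry is `r`, in position `(i, j)`. -/
def single (i j : Fin 3) (r : R) (h : i = 2 ∨ ev r = 0) : A :=
  ⟨Matrix.single i j r, by
    refine ⟨?_, ?_, ?_, ?_⟩ <;> rcases h with rfl | h <;>
      simp only [ev, Matrix.single_apply] at * <;> split_ifs <;> simp_all⟩

theorem mat_single (i j : Fin 3) (r : R) (h : i = 2 ∨ ev r = 0) :
    mat (single i j r h) = Matrix.single i j r := rfl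

theorem single_smul_entry {n : ℕ} (i j : Fin 3) (r : R) (h : i = 2 ∨ ev r = 0) (x : Mat n)
    (i' : Fin 3) (k : Fin n) :
    (single i j r h • x) i' k = if i' = i then r * x j k else 0 := by
  rw [smul_entry, mat_single]
  rcases eq_or_ne i' i with rfl | hi
  · fin_cases j <;> simp
  · simp [hi, hi.symm]

/-- The inclusion of `R` into `A` as scalar matrices. -/
def scalar : R →ₐ[ℝ] A :=
  (Algebra.ofId R (Matrix (Fin 3) (Fin 3) R)).restrictScalars ℝ |>.codRestrict gelfandOrder
    fun r => by
      refine ⟨?_, ?_, ?_, ?_⟩ <;> simp [ev, Algebra.ofId_apply, Matrix.algebraMap_matrix_apply]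

theorem scalar_smul_entry {n : ℕ} (r : R) (x : Mat n) (i : Fin 3) (j : Fin n) :
    (scalar r • x) i j = r * x i j := by
  have h : mat (scalar r) = algebraMap R (Matrix (Fin 3) (Fin 3) R) r := rfl
  rw [smul_entry, h]
  fin_cases i <;> simp [Matrix.algebraMap_matrix_apply]

theorem toC_re (a : A) : (toC a).re = ev (mat a 0 0) := rfl

theorem toC_im (a : A) : (toC a).im = ev (mat a 1 0) := rfl

theorem toC_surjective : Function.Surjective toC := fun z =>
  ⟨⟨!![C z.re, - C z.im, 0; C z.im, C z.re, 0; 0, 0, 0], by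
    refine ⟨?_, ?_, ?_, ?_⟩ <;> simp [ev]⟩, by
    apply Complex.ext
    · exact constantCoeff_C z.re
    · exact constantCoeff_C z.im⟩

instance : RingHomSurjective toC := ⟨toC_surjective⟩

/-! ### Lattices cut out by a complex subspace -/

section Residue

variable {n m p : ℕ}

/-- The upper two rows modulo `𝔪`, combined to a complex vector. The action of `A` on it is through
`toC`, so it is semilinear. -/
def residue : Mat n →ₛₗ[toC] (Fin n → ℂ) where
  toFun x j := ⟨ev (x 0 j), ev (x 1 j)⟩
  map_add' x y := by
    funext j
    apply Complex.ext <;> simp [add_entry]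
  map_smul' a x := by
    obtain ⟨h02, h12, h00, h10⟩ := mat_mem a
    simp only [ev] at h02 h12 h00 h10
    funext j
    apply Complex.ext
    · simp [smul_entry, toC_re, toC_im, h02, h10]
    · simp [smul_entry, toC_re, toC_im, h12, h00]
      ring

theorem residue_apply (x : Mat n) (j : Fin n) : residue x j = ⟨ev (x 0 j), ev (x 1 j)⟩ := rfl

theorem residue_surjective : Function.Surjective (residue (n := n)) := fun u =>
  ⟨fun i j => ![C (u j).re, C (u j).im, 0] i,
    funext fun _ => Complex.ext (constantCoeff_C _) (constantCoeff_C _)⟩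

theorem residue_eq_zero_iff {x : Mat n} : residue x = 0 ↔ ∀ j, t ∣ x 0 j ∧ t ∣ x 1 j := by
  simp only [funext_iff, residue_apply, Pi.zero_apply, Complex.ext_iff, Complex.zero_re,
    Complex.zero_im, X_dvd_iff]

/-- The lattice of matrices whose residue lies in a given complex subspace. -/
def residueLattice (W : Submodule ℂ (Fin n → ℂ)) : Submodule A (Mat n) := W.comap residue

theorem mem_residueLattice {W : Submodule ℂ (Fin n → ℂ)} {w : Mat n} :
    w ∈ residueLattice W ↔ residue w ∈ W := Iff.rfl

theorem rmul_rmul (Y : Matrix (Fin n) (Fin m) R) (Z : Matrix (Fin m) (Fin p) R) (x : Mat n) :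
    rmul Z (rmul Y x) = rmul (Y * Z) x :=
  Matrix.mul_assoc (show Matrix (Fin 3) (Fin n) R from x) Y Z

theorem rmul_one (x : Mat n) : rmul 1 x = x :=
  Matrix.mul_one (show Matrix (Fin 3) (Fin n) R from x)

theorem map_rmul_map_rmul (F : Submodule A (Mat n)) (Y : Matrix (Fin n) (Fin m) R)
    (Z : Matrix (Fin m) (Fin p) R) : (F.map (rmul Y)).map (rmul Z) = F.map (rmul (Y * Z)) := by
  rw [← Submodule.map_comp]
  exact congrArg (F.map ·) (LinearMap.ext (rmul_rmul Y Z))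

theorem map_rmul_one (F : Submodule A (Mat n)) : F.map (rmul 1) = F :=
  (congrArg (F.map ·) (LinearMap.ext rmul_one)).trans F.map_id

/-- The action of a matrix over `R` on complex row vectors, through its constant coefficients. -/
def residueAct (Y : Matrix (Fin n) (Fin m) R) : (Fin n → ℂ) →ₗ[ℂ] (Fin m → ℂ) :=
  Matrix.vecMulLinear (Y.map fun p => (ev p : ℂ))

theorem residueAct_apply (Y : Matrix (Fin n) (Fin m) R) (u : Fin n → ℂ) (j : Fin m) :
    residueAct Y u j = ∑ s, u s * (ev (Y s j) : ℂ) := rfl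

theorem residue_rmul (Y : Matrix (Fin n) (Fin m) R) (w : Mat n) :
    residue (rmul Y w) = residueAct Y (residue w) := by
  funext j
  rw [residueAct_apply]
  apply Complex.ext <;> simp [residue_apply, rmul_entry, Complex.re_sum, Complex.im_sum]

theorem map_rmul_residueLattice (W : Submodule ℂ (Fin n → ℂ)) {Y : Matrix (Fin n) (Fin n) R}
    (hY : IsUnit Y) :
    (residueLattice W).map (rmul Y) = residueLattice (W.map (residueAct Y)) := by
  obtain ⟨Y', h, h'⟩ := isUnit_iff_exists.1 hY
  apply le_antisymm
  · rintro _ ⟨w, hw, rfl⟩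
    exact ⟨residue w, hw, (residue_rmul Y w).symm⟩
  · rintro x ⟨u, hu, hx⟩
    obtain ⟨w, rfl⟩ := residue_surjective u
    have hw : residue (rmul Y' x) = residue w := by
      rw [residue_rmul, ← hx, ← residue_rmul, ← residue_rmul, rmul_rmul, h, rmul_one]
    refine ⟨rmul Y' x, ?_, by rw [rmul_rmul, h', rmul_one]⟩
    rw [SetLike.mem_coe, mem_residueLattice, hw]
    exact hu

end Residue

/-! ### Diagonal multiples of these lattices -/

section DiagLattice

variable {n m : ℕ}

/-- The diagonal matrix with entries `t ^ d j`. -/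
def diag (d : Fin n → ℕ) : Matrix (Fin n) (Fin n) R := Matrix.diagonal fun j => t ^ d j

theorem diag_zero : diag (0 : Fin n → ℕ) = 1 := by simp [diag]

theorem rmul_diag_entry (d : Fin n → ℕ) (x : Mat n) (i : Fin 3) (j : Fin n) :
    rmul (diag d) x i j = x i j * t ^ d j := by
  rw [rmul_entry]
  simp [diag, Matrix.diagonal_apply]

theorem rmul_diag_injective (d : Fin n → ℕ) : Function.Injective (rmul (diag d)) := by
  intro x y h
  ext i j : 1
  have hij : rmul (diag d) x i j = rmul (diag d) y i j := by rw [h]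
  rw [rmul_diag_entry, rmul_diag_entry] at hij
  exact mul_right_cancel₀ (pow_ne_zero _ X_ne_zero) hij

theorem mem_range_rmul_diag {d : Fin n → ℕ} {x : Mat n} :
    x ∈ LinearMap.range (rmul (diag d)) ↔ ∀ i j, t ^ d j ∣ x i j := by
  constructor
  · rintro ⟨w, rfl⟩ i j
    exact Dvd.intro_left (w i j) (rmul_diag_entry d w i j).symm
  · intro h
    choose w hw using h
    exact ⟨w, Mat.ext fun i j => by rw [hw, mul_comm]; exact rmul_diag_entry d w i j⟩

/-- The lattice `residueLattice W`, multiplied from the right by a diagonal matrix. -/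
def diagLattice (d : Fin n → ℕ) (W : Submodule ℂ (Fin n → ℂ)) : Submodule A (Mat n) :=
  (residueLattice W).map (rmul (diag d))

theorem rmul_diag_mem_diagLattice_iff {d : Fin n → ℕ} {W : Submodule ℂ (Fin n → ℂ)} {w : Mat n} :
    rmul (diag d) w ∈ diagLattice d W ↔ residue w ∈ W := by
  rw [diagLattice, ← Submodule.mem_comap,
    Submodule.comap_map_eq_of_injective (rmul_diag_injective d), mem_residueLattice]

theorem diagLattice_zero (W : Submodule ℂ (Fin n → ℂ)) : diagLattice 0 W = residueLattice W := by
  rw [diagLattice, diag_zero, map_rmul_one]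

theorem t_pow_dvd_of_mem_diagLattice {d : Fin n → ℕ} {W : Submodule ℂ (Fin n → ℂ)} {x : Mat n}
    (hx : x ∈ diagLattice d W) (i : Fin 3) (j : Fin n) : t ^ d j ∣ x i j :=
  mem_range_rmul_diag.1 (LinearMap.map_le_range hx) i j

/-- The matrix with a given last row and zeros elsewhere. -/
def lastRow : (Fin n → R) →ₛₗ[(scalar : R →+* A)] Mat n where
  toFun v i j := if i = 2 then v j else 0
  map_add' v w := by
    funext i j
    change (if i = 2 then v j + w j else 0) = (if i = 2 then v j else 0) + if i = 2 then w j else 0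
    split_ifs <;> simp
  map_smul' r v := by
    funext i j
    exact (mul_ite_zero (i = 2) r (v j)).symm.trans
      (scalar_smul_entry r (fun i j => if i = 2 then v j else 0 : Mat n) i j).symm

theorem lastRow_entry (v : Fin n → R) (i : Fin 3) (j : Fin n) :
    lastRow v i j = if i = 2 then v j else 0 := rfl

theorem residue_lastRow (v : Fin n → R) : residue (lastRow v) = 0 :=
  residue_eq_zero_iff.2 fun _ => ⟨dvd_zero t, dvd_zero t⟩

theorem rmul_lastRow (Y : Matrix (Fin n) (Fin m) R) (v : Fin n → R) :
    rmul Y (lastRow v) = lastRow (Matrix.vecMul v Y) := by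
  ext i j : 1
  rw [rmul_entry, lastRow_entry]
  split_ifs with h <;> simp [lastRow_entry, h, Matrix.vecMul, dotProduct]

theorem lastRow_mem_of_mem {N : Submodule A (Mat n)} {x : Mat n} (hx : x ∈ N) (i : Fin 3) :
    lastRow (x i) ∈ N := by
  have h : single 2 i 1 (Or.inl rfl) • x = lastRow (x i) := by
    ext i' j : 1
    rw [single_smul_entry, lastRow_entry, one_mul]
  exact h ▸ N.smul_mem _ hx

theorem ker_residue_le {N : Submodule A (Mat n)} (h : ∀ v, lastRow v ∈ N) :
    LinearMap.ker residue ≤ N := by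
  intro x hx
  have hdvd := residue_eq_zero_iff.1 hx
  choose y hy using fun j => (hdvd j).1
  choose z hz using fun j => (hdvd j).2
  have ht : ev t = 0 := constantCoeff_X
  have hsum : single 0 2 t (Or.inr ht) • lastRow y + single 1 2 t (Or.inr ht) • lastRow z +
      lastRow (x 2) = x := by
    ext i j : 1
    simp only [add_entry, single_smul_entry, lastRow_entry]
    fin_cases i <;> simp [hy, hz]
  rw [← hsum]
  exact N.add_mem (N.add_mem (N.smul_mem _ (h y)) (N.smul_mem _ (h z))) (h (x 2))

theorem exists_eq_diagLattice (N : Submodule A (Mat n)) (d : Fin n → ℕ)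
    (h : ∀ v : Fin n → R, lastRow v ∈ N ↔ ∀ j, t ^ d j ∣ v j) : ∃ W, N = diagLattice d W := by
  have hrange : N ≤ LinearMap.range (rmul (diag d)) := fun x hx =>
    mem_range_rmul_diag.2 fun i => (h _).1 (lastRow_mem_of_mem hx i)
  have hker : LinearMap.ker residue ≤ N.comap (rmul (diag d)) := by
    refine ker_residue_le fun v => ?_
    rw [Submodule.mem_comap, rmul_lastRow, h]
    exact fun j => Dvd.intro_left (v j) (by simp [diag, Matrix.vecMul_diagonal])
  refine ⟨(N.comap (rmul (diag d))).map residue, ?_⟩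
  rw [diagLattice, residueLattice, Submodule.comap_map_eq_self hker,
    Submodule.map_comap_eq_self hrange]

end DiagLattice

/-! ### Dimension vectors -/

section DimVector

variable {K M M' : Type*} [AddCommGroup K] [Module ℝ K] [Module A K] [IsScalarTower ℝ A K]
  [AddCommGroup M] [Module ℝ M] [Module A M] [IsScalarTower ℝ A M]
  [AddCommGroup M'] [Module ℝ M'] [Module A M'] [IsScalarTower ℝ A M']

theorem finrank_range_lsmul_of_exact [Module.Finite ℝ M] {a : A} (ha : a * a = a)
    {i : K →ₗ[A] M} {p : M →ₗ[A] M'} (hi : Function.Injective i) (hip : Function.Exact i p)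
    (hp : Function.Surjective p) :
    Module.finrank ℝ (LinearMap.range (Algebra.lsmul ℝ ℝ M a)) =
      Module.finrank ℝ (LinearMap.range (Algebra.lsmul ℝ ℝ K a)) +
        Module.finrank ℝ (LinearMap.range (Algebra.lsmul ℝ ℝ M' a)) := by
  let aM := LinearMap.range (Algebra.lsmul ℝ ℝ M a)
  let g : aM →ₗ[ℝ] M' := (p.restrictScalars ℝ).domRestrict aM
  have hrange : LinearMap.range g = LinearMap.range (Algebra.lsmul ℝ ℝ M' a) := by
    ext y
    constructor
    · rintro ⟨⟨_, x, rfl⟩, rfl⟩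
      exact ⟨p x, (map_smul p a x).symm⟩
    · rintro ⟨y, rfl⟩
      obtain ⟨x, rfl⟩ := hp y
      exact ⟨⟨a • x, x, rfl⟩, map_smul p a x⟩
  have hker : (LinearMap.ker g).map aM.subtype =
      (LinearMap.range (Algebra.lsmul ℝ ℝ K a)).map (i.restrictScalars ℝ) := by
    ext y
    constructor
    · rintro ⟨⟨_, x, rfl⟩, hx, rfl⟩
      obtain ⟨z, hz⟩ := (hip (a • x)).1 hx
      refine ⟨a • z, ⟨z, rfl⟩, (map_smul i a z).trans ?_⟩
      rw [hz, ← mul_smul, ha]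
      rfl
    · rintro ⟨_, ⟨z, rfl⟩, rfl⟩
      exact ⟨⟨i (a • z), i z, (map_smul i a z).symm⟩, (hip _).2 ⟨a • z, rfl⟩, rfl⟩
  have hK := LinearEquiv.finrank_eq (Submodule.equivMapOfInjective (i.restrictScalars ℝ) hi
    (LinearMap.range (Algebra.lsmul ℝ ℝ K a)))
  rw [← g.finrank_range_add_finrank_ker, hrange, ← Submodule.finrank_map_subtype_eq, hker,
    ← hK, add_comm]

theorem HasDimVector.of_exact {i : K →ₗ[A] M} {p : M →ₗ[A] M'} {d d' : ℕ × ℕ}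
    (hi : Function.Injective i) (hip : Function.Exact i p) (hp : Function.Surjective p)
    (hM : HasDimVector M (d + d')) (hM' : HasDimVector M' d') : HasDimVector K d := by
  have := hM.finite
  have he := finrank_range_lsmul_of_exact e_mul_e hi hip hp
  have hf := finrank_range_lsmul_of_exact f_mul_f hi hip hp
  rw [hM.dim_e, hM'.dim_e, Prod.fst_add] at he
  rw [hM.dim_f, hM'.dim_f, Prod.snd_add] at hf
  exact ⟨Module.Finite.of_injective (i.restrictScalars ℝ) hi, by omega, by omega⟩

theorem HasDimVector.of_equiv {d : ℕ × ℕ} (h : HasDimVector M d) (φ : M ≃ₗ[A] K) :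
    HasDimVector K d := by
  have h0 : HasDimVector (⊥ : Submodule A K) 0 :=
    ⟨inferInstance, Module.finrank_zero_of_subsingleton, Module.finrank_zero_of_subsingleton⟩
  exact .of_exact (i := (φ.symm : K →ₗ[A] M)) (p := (0 : M →ₗ[A] (⊥ : Submodule A K)))
    φ.symm.injective (fun x => iff_of_true rfl (φ.symm.surjective x))
    (Function.surjective_to_subsingleton _) ((add_zero d).symm ▸ h) h0

theorem HasDimVector.unique {d d' : ℕ × ℕ} (h : HasDimVector M d) (h' : HasDimVector M d') :
    d = d' := by
  have he := h.dim_e.symm.trans h'.dim_e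
  exact Prod.ext (by omega) (h.dim_f.symm.trans h'.dim_f)

theorem HasDimVector.ne_top {N : Submodule A M} {d : ℕ × ℕ} (h : HasDimVector (M ⧸ N) d)
    (hd : d ≠ 0) : N ≠ ⊤ := by
  rintro rfl
  have h0 : HasDimVector (M ⧸ (⊤ : Submodule A M)) 0 :=
    ⟨h.finite, Module.finrank_zero_of_subsingleton, Module.finrank_zero_of_subsingleton⟩
  exact hd (h.unique h0)

theorem HasDimVector.of_le {N F : Submodule A M} {d d' : ℕ × ℕ} (hNF : N ≤ F)
    (hN : HasDimVector (M ⧸ N) (d + d')) (hF : HasDimVector (M ⧸ F) d') :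
    HasDimVector (F ⧸ N.submoduleOf F) d := by
  refine .of_exact (K := F ⧸ N.comap F.subtype) (i := (N.comap F.subtype).mapQ N F.subtype le_rfl)
    (p := Submodule.factor hNF) ?_ ?_ (Submodule.factor_surjective hNF) hN hF
  · rw [← LinearMap.ker_eq_bot, Submodule.ker_mapQ, Submodule.mkQ_map_self]
  · rw [LinearMap.exact_iff, Submodule.range_mapQ, F.range_subtype, Submodule.factor,
      Submodule.ker_mapQ, Submodule.comap_id]

theorem finite_of_range_lsmul (he : Module.Finite ℝ (LinearMap.range (Algebra.lsmul ℝ ℝ M e)))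
    (hf : Module.Finite ℝ (LinearMap.range (Algebra.lsmul ℝ ℝ M f))) : Module.Finite ℝ M := by
  have hsup : (LinearMap.range (Algebra.lsmul ℝ ℝ M e)) ⊔
      LinearMap.range (Algebra.lsmul ℝ ℝ M f) = ⊤ := by
    refine eq_top_iff.2 fun x _ => ?_
    have hx : e • x + f • x = x := by rw [← add_smul, e_add_f, one_smul]
    exact hx ▸ Submodule.add_mem_sup ⟨x, rfl⟩ ⟨x, rfl⟩
  rw [Module.finite_def, ← hsup]
  exact Submodule.FG.sup (Module.Finite.iff_fg.1 he) (Module.Finite.iff_fg.1 hf)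

theorem nonempty_range_lsmul_quotient_equiv {Y : Type*} [AddCommGroup Y] [Module ℝ Y] {a : A}
    {N : Submodule A M} {ψ : M →ₗ[ℝ] Y} (hψ : Function.Surjective ψ)
    (h : ∀ x, ψ x = 0 ↔ a • x ∈ N) :
    Nonempty (LinearMap.range (Algebra.lsmul ℝ ℝ (M ⧸ N) a) ≃ₗ[ℝ] Y) := by
  let g : M →ₗ[ℝ] M ⧸ N := (Algebra.lsmul ℝ ℝ (M ⧸ N) a).comp (N.mkQ.restrictScalars ℝ)
  have hg : LinearMap.range g = LinearMap.range (Algebra.lsmul ℝ ℝ (M ⧸ N) a) :=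
    LinearMap.range_comp_of_range_eq_top _ (LinearMap.range_eq_top.2 N.mkQ_surjective)
  have hk : LinearMap.ker g = LinearMap.ker ψ := by
    ext x
    rw [LinearMap.mem_ker, LinearMap.mem_ker, h]
    exact Submodule.Quotient.mk_eq_zero N (x := a • x)
  rw [← hg]
  exact ⟨g.quotKerEquivRange.symm ≪≫ₗ Submodule.quotEquivOfEq _ _ hk ≪≫ₗ
    ψ.quotKerEquivOfSurjective hψ⟩

theorem HasDimVector.of_surjective {Y Z : Type*} [AddCommGroup Y] [Module ℝ Y] [AddCommGroup Z]
    [Module ℝ Z] [Module.Finite ℝ Y] [Module.Finite ℝ Z] {N : Submodule A M} {φ : M →ₗ[ℝ] Y}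
    {ψ : M →ₗ[ℝ] Z} (hφ : Function.Surjective φ) (hφN : ∀ x, φ x = 0 ↔ e • x ∈ N)
    (hψ : Function.Surjective ψ) (hψN : ∀ x, ψ x = 0 ↔ f • x ∈ N) {d : ℕ × ℕ}
    (hY : Module.finrank ℝ Y = 2 * d.1) (hZ : Module.finrank ℝ Z = d.2) :
    HasDimVector (M ⧸ N) d := by
  obtain ⟨E⟩ := nonempty_range_lsmul_quotient_equiv hφ hφN
  obtain ⟨F⟩ := nonempty_range_lsmul_quotient_equiv hψ hψN
  exact ⟨finite_of_range_lsmul (.equiv E.symm) (.equiv F.symm), E.finrank_eq.trans hY,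
    F.finrank_eq.trans hZ⟩

end DimVector

/-! ### The dimension vector of a quotient of diagonal lattices -/

section Coefficients

variable {n : ℕ}

/-- The `m`-th coefficients of the upper two entries in column `j`, combined to a complex number. -/
def complexCoeff (j : Fin n) (m : ℕ) : Mat n →ₗ[ℝ] ℂ where
  toFun x := ⟨coeff m (x 0 j), coeff m (x 1 j)⟩
  map_add' x y := by apply Complex.ext <;> simp [add_entry]
  map_smul' r x := by apply Complex.ext <;> simp [real_smul_entry]

theorem complexCoeff_apply (j : Fin n) (m : ℕ) (x : Mat n) :
    complexCoeff j m x = ⟨coeff m (x 0 j), coeff m (x 1 j)⟩ := rfl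

theorem complexCoeff_eq_zero_iff {j : Fin n} {m : ℕ} {x : Mat n} :
    complexCoeff j m x = 0 ↔ coeff m (x 0 j) = 0 ∧ coeff m (x 1 j) = 0 :=
  Complex.ext_iff

theorem complexCoeff_rmul_diag (d : Fin n → ℕ) (j : Fin n) (x : Mat n) :
    complexCoeff j (d j) (rmul (diag d) x) = residue x j := by
  rw [complexCoeff_apply, residue_apply, rmul_diag_entry, rmul_diag_entry]
  simp [coeff_mul_X_pow']

theorem complexCoeff_e_smul (j : Fin n) (m : ℕ) (x : Mat n) :
    complexCoeff j m (e • x) = complexCoeff j m x := by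
  simp [complexCoeff_apply, e_smul_entry]

theorem forall_fin_three {p : Fin 3 → Prop} : (∀ i, p i) ↔ p 0 ∧ p 1 ∧ p 2 := by
  simp only [Fin.forall_fin_succ, IsEmpty.forall_iff, and_true]
  rfl

theorem mem_diagLattice_iff {d : Fin n → ℕ} {W : Submodule ℂ (Fin n → ℂ)} {x : Mat n} :
    x ∈ diagLattice d W ↔
      (∀ i j, t ^ d j ∣ x i j) ∧ (fun j => complexCoeff j (d j) x) ∈ W := by
  constructor
  · rintro ⟨w, hw, rfl⟩
    refine ⟨mem_range_rmul_diag.1 ⟨w, rfl⟩, ?_⟩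
    rwa [funext fun j => complexCoeff_rmul_diag d j w]
  · rintro ⟨hdvd, hx⟩
    obtain ⟨w, rfl⟩ := mem_range_rmul_diag.2 hdvd
    rw [funext fun j => complexCoeff_rmul_diag d j w] at hx
    exact rmul_diag_mem_diagLattice_iff.2 hx

/-- The coefficients that detect whether the upper rows of a matrix lie in `diagLattice d W`. -/
def upperCoeffs (d : Fin n → ℕ) (W : Submodule ℂ (Fin n → ℂ)) :
    Mat n →ₗ[ℝ] ((j : Fin n) → Fin (d j) → ℂ) × ((Fin n → ℂ) ⧸ W) :=
  (LinearMap.pi fun j => LinearMap.pi fun m : Fin (d j) => complexCoeff j m).prod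
    (W.mkQ.restrictScalars ℝ ∘ₗ LinearMap.pi fun j => complexCoeff j (d j))

/-- The coefficients that detect whether the last row of a matrix lies in `diagLattice d W`. -/
def lastRowCoeffs (d : Fin n → ℕ) : Mat n →ₗ[ℝ] ((j : Fin n) → Fin (d j) → ℝ) where
  toFun x j m := coeff m (x 2 j)
  map_add' x y := by funext j m; simp [add_entry]
  map_smul' r x := by funext j m; simp [real_smul_entry]

theorem upperCoeffs_surjective (d : Fin n → ℕ) (W : Submodule ℂ (Fin n → ℂ)) :
    Function.Surjective (upperCoeffs d W) := by
  rintro ⟨y, z⟩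
  obtain ⟨z, rfl⟩ := W.mkQ_surjective z
  let q : Fin n → ℕ → ℂ := fun j m => if h : m < d j then y j ⟨m, h⟩ else z j
  let x : Mat n := fun i j => ![PowerSeries.mk fun m => (q j m).re,
    PowerSeries.mk fun m => (q j m).im, 0] i
  have hx : ∀ j m, complexCoeff j m x = q j m := fun j m =>
    Complex.ext (coeff_mk m fun m => (q j m).re) (coeff_mk m fun m => (q j m).im)
  refine ⟨x, Prod.ext ?_ (congrArg W.mkQ ?_)⟩
  · funext j m
    exact (hx j m).trans (dif_pos m.2)
  · funext j
    exact (hx j (d j)).trans (dif_neg (lt_irrefl _))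

theorem lastRowCoeffs_surjective (d : Fin n → ℕ) : Function.Surjective (lastRowCoeffs d) := by
  intro y
  refine ⟨lastRow fun j => PowerSeries.mk fun m => if h : m < d j then y j ⟨m, h⟩ else 0, ?_⟩
  funext j m
  simp [lastRowCoeffs, lastRow_entry]

theorem upperCoeffs_eq_zero_iff {d : Fin n → ℕ} {W : Submodule ℂ (Fin n → ℂ)} {x : Mat n} :
    upperCoeffs d W x = 0 ↔ e • x ∈ diagLattice d W := by
  have hdvd : (∀ j (m : Fin (d j)), complexCoeff j m x = 0) ↔
      ∀ i j, t ^ d j ∣ (e • x) i j := by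
    simp only [complexCoeff_eq_zero_iff, e_smul_entry, X_pow_dvd_iff, forall_fin_three]
    simp [Fin.forall_iff, forall_and]
  rw [mem_diagLattice_iff, ← hdvd]
  simp only [complexCoeff_e_smul]
  rw [Prod.ext_iff, funext_iff]
  simp only [funext_iff]
  exact and_congr Iff.rfl (Submodule.Quotient.mk_eq_zero W)

theorem lastRowCoeffs_eq_zero_iff {d : Fin n → ℕ} {W : Submodule ℂ (Fin n → ℂ)} {x : Mat n} :
    lastRowCoeffs d x = 0 ↔ f • x ∈ diagLattice d W := by
  have hcoeff : (fun j => complexCoeff j (d j) (f • x)) = 0 := by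
    funext j
    simp [complexCoeff_apply, f_smul_entry, Complex.ext_iff]
  rw [mem_diagLattice_iff, hcoeff, and_iff_left W.zero_mem]
  simp only [funext_iff, forall_fin_three, f_smul_entry, X_pow_dvd_iff]
  simp [lastRowCoeffs, Fin.forall_iff]

theorem hasDimVector_quotient_diagLattice (d : Fin n → ℕ) (W : Submodule ℂ (Fin n → ℂ)) :
    HasDimVector (Mat n ⧸ diagLattice d W)
      (∑ j, d j + Module.finrank ℂ ((Fin n → ℂ) ⧸ W), ∑ j, d j) := by
  refine .of_surjective (upperCoeffs_surjective d W) (fun _ => upperCoeffs_eq_zero_iff)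
    (lastRowCoeffs_surjective d) (fun _ => lastRowCoeffs_eq_zero_iff) ?_ ?_
  · simp only [Module.finrank_prod, Module.finrank_pi_fintype, finrank_real_of_complex,
      Module.finrank_self, Finset.sum_const, Finset.card_univ, Fintype.card_fin, smul_eq_mul,
      ← Finset.sum_mul]
    ring
  · simp [Module.finrank_pi_fintype]

theorem HasDimVector.of_map_subtype_eq {F : Submodule A (Mat n)} {N : Submodule A F}
    {d : Fin n → ℕ} {W W₀ : Submodule ℂ (Fin n → ℂ)} (hF : F = residueLattice W₀)
    (hN : N.map F.subtype = diagLattice d W) {m : ℕ}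
    (hm : m + Module.finrank ℂ W = ∑ j, d j + Module.finrank ℂ W₀) :
    HasDimVector (F ⧸ N) (m, ∑ j, d j) := by
  subst hF
  have h : diagLattice d W ≤ residueLattice W₀ := hN ▸ Submodule.map_subtype_le _ _
  rw [← Submodule.comap_map_eq_of_injective (Submodule.injective_subtype _) N, hN]
  have hW := Submodule.finrank_quotient_add_finrank W
  have hW₀ := Submodule.finrank_quotient_add_finrank W₀
  refine .of_le h ?_ (diagLattice_zero W₀ ▸ hasDimVector_quotient_diagLattice 0 W₀)
  convert hasDimVector_quotient_diagLattice d W using 1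
  ext
  · simp only [Prod.fst_add, Pi.zero_apply, Finset.sum_const_zero]
    omega
  · simp

end Coefficients

/-! ### Tops and generators -/

section Top

variable {B X Y : Type*} [Ring B] [AddCommGroup X] [Module B X] [AddCommGroup Y] [Module B Y]

theorem isCoatom_ker [Nontrivial Y] {g : X →ₗ[B] Y} (hg : Function.Surjective g)
    (h : ∀ x, g x ≠ 0 → Submodule.span B {x} = ⊤) : IsCoatom (LinearMap.ker g) := by
  constructor
  · intro hker
    rw [LinearMap.ker_eq_top] at hker
    obtain ⟨y, hy⟩ := exists_ne (0 : Y)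
    obtain ⟨x, rfl⟩ := hg y
    exact hy (by rw [hker, LinearMap.zero_apply])
  · intro N hN
    obtain ⟨x, hxN, hx⟩ := SetLike.exists_of_lt hN
    rw [eq_top_iff, ← h x hx]
    exact N.span_singleton_le_iff_mem x |>.2 hxN

theorem le_ker_of_ne_top {g : X →ₗ[B] Y} (h : ∀ x, g x ≠ 0 → Submodule.span B {x} = ⊤)
    {N : Submodule B X} (hN : N ≠ ⊤) : N ≤ LinearMap.ker g := by
  intro x hx
  by_contra hgx
  exact hN (eq_top_iff.2 (h x hgx ▸ (N.span_singleton_le_iff_mem x).2 hx))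

theorem jacobson_eq_ker [Nontrivial Y] {g : X →ₗ[B] Y} (hg : Function.Surjective g)
    (h : ∀ x, g x ≠ 0 → Submodule.span B {x} = ⊤) : Module.jacobson B X = LinearMap.ker g := by
  have hcoatom := isCoatom_ker hg h
  refine le_antisymm (sInf_le hcoatom) (le_sInf fun N hN => ?_)
  exact ((hN.le_iff.1 (le_ker_of_ne_top h hN.1)).resolve_left hcoatom.1).le

theorem isSimpleModule_top [Nontrivial Y] {g : X →ₗ[B] Y} (hg : Function.Surjective g)
    (h : ∀ x, g x ≠ 0 → Submodule.span B {x} = ⊤) :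
    IsSimpleModule B (X ⧸ Module.jacobson B X) := by
  rw [isSimpleModule_iff_isCoatom, jacobson_eq_ker hg h]
  exact isCoatom_ker hg h

theorem nonempty_top_equiv [Nontrivial Y] {g : X →ₗ[B] Y} (hg : Function.Surjective g)
    (h : ∀ x, g x ≠ 0 → Submodule.span B {x} = ⊤) :
    Nonempty ((X ⧸ Module.jacobson B X) ≃ₗ[B] Y) :=
  ⟨Submodule.quotEquivOfEq _ _ (jacobson_eq_ker hg h) ≪≫ₗ g.quotKerEquivOfSurjective hg⟩

theorem exists_surjective_quotient {g : X →ₗ[B] Y} (hg : Function.Surjective g)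
    (h : ∀ x, g x ≠ 0 → Submodule.span B {x} = ⊤) {N : Submodule B X} (hN : N ≠ ⊤) :
    ∃ g' : X ⧸ N →ₗ[B] Y, Function.Surjective g' ∧
      ∀ z, g' z ≠ 0 → Submodule.span B {z} = ⊤ := by
  have hle := le_ker_of_ne_top h hN
  refine ⟨N.liftQ g hle, fun y => ?_, fun z hz => ?_⟩
  · obtain ⟨x, rfl⟩ := hg y
    exact ⟨N.mkQ x, rfl⟩
  · obtain ⟨x, rfl⟩ := N.mkQ_surjective z
    rw [← Set.image_singleton, Submodule.span_image, h x hz, Submodule.map_top,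
      Submodule.range_mkQ]

theorem nonempty_top_equiv_of_equiv (φ : X ≃ₗ[B] Y) :
    Nonempty ((X ⧸ Module.jacobson B X) ≃ₗ[B] (Y ⧸ Module.jacobson B Y)) :=
  ⟨Submodule.Quotient.equiv _ _ φ (Module.map_jacobson_of_bijective φ.bijective)⟩

theorem span_singleton_eq_top_of_notMem_jacobson [Module.Finite B X]
    (h : IsCoatom (Module.jacobson B X)) {x : X} (hx : x ∉ Module.jacobson B X) :
    Submodule.span B {x} = ⊤ := by
  refine (eq_top_or_exists_le_coatom _).resolve_right ?_
  rintro ⟨K, hK, hxK⟩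
  have hKeq := (h.le_iff.1 (sInf_le hK : Module.jacobson B X ≤ K)).resolve_left hK.1
  exact hx (hKeq ▸ (K.span_singleton_le_iff_mem x).1 hxK)

theorem exists_quotient_equiv_of_generator [Nontrivial Y] (emb : X →ₗ[B] B) {x : X} {y : Y}
    (hy : emb x • y = y) (hspan : Submodule.span B {y} = ⊤) :
    ∃ N : Submodule B X, N ≠ ⊤ ∧ Nonempty (Y ≃ₗ[B] X ⧸ N) := by
  let φ : X →ₗ[B] Y := LinearMap.toSpanSingleton B Y y ∘ₗ emb
  have hφ : Function.Surjective φ := by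
    rw [← LinearMap.range_eq_top, eq_top_iff, ← hspan, Submodule.span_singleton_le_iff_mem]
    exact ⟨x, hy⟩
  let E := φ.quotKerEquivOfSurjective hφ
  exact ⟨LinearMap.ker φ, Submodule.Quotient.nontrivial_iff.1 E.toEquiv.nontrivial, ⟨E.symm⟩⟩

end Top

/-! ### The projective lattices -/

/-- The embedding of `P = A e` into `A` by a zero third column. -/
def embP : P →ₗ[A] A where
  toFun x := ⟨rmul !![1, 0, 0; 0, 1, 0] x.1, by
    exact ⟨by simp [rmul_entry], by simp [rmul_entry], by simpa [rmul_entry] using x.2.1,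
      by simpa [rmul_entry] using x.2.2⟩⟩
  map_add' x y := Subtype.ext (map_add (rmul _) x.1 y.1)
  map_smul' a x := Subtype.ext (map_smul (rmul _) a x.1)

/-- The embedding of `Q = A f` into `A` by two zero columns on the left. -/
def embQ : Q →ₗ[A] A where
  toFun x := ⟨rmul !![0, 0, 1] x.1, by
    exact ⟨by simpa [rmul_entry] using x.2.1, by simpa [rmul_entry] using x.2.2,
      by simp [rmul_entry], by simp [rmul_entry]⟩⟩
  map_add' x y := Subtype.ext (map_add (rmul _) x.1 y.1)
  map_smul' a x := Subtype.ext (map_smul (rmul _) a x.1)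

theorem mat_embP (x : P) : mat (embP x) = rmul !![1, 0, 0; 0, 1, 0] x.1 := rfl

theorem mat_embQ (x : Q) : mat (embQ x) = rmul !![0, 0, 1] x.1 := rfl

/-- The generator `e` of `P = A e`. -/
def genP : P := ⟨(!![1, 0; 0, 1; 0, 0] : Matrix (Fin 3) (Fin 2) R), by constructor <;> simp [ev]⟩

/-- The generator `f` of `Q = A f`. -/
def genQ : Q := ⟨(!![0; 0; 1] : Matrix (Fin 3) (Fin 1) R), by constructor <;> simp [ev]⟩

theorem genP_val : genP.1 = (!![1, 0; 0, 1; 0, 0] : Matrix (Fin 3) (Fin 2) R) := rfl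

theorem genQ_val : genQ.1 = (!![0; 0; 1] : Matrix (Fin 3) (Fin 1) R) := rfl

theorem embP_genP : embP genP = e := by
  ext i j : 1
  rw [mat_embP, mat_e, rmul_entry, genP_val]
  fin_cases i <;> fin_cases j <;> simp

theorem embQ_genQ : embQ genQ = f := by
  ext i j : 1
  rw [mat_embQ, mat_f, rmul_entry, genQ_val]
  fin_cases i <;> fin_cases j <;> simp

theorem embP_smul_genP (x : P) : embP x • genP = x := by
  ext i j : 2
  rw [Submodule.coe_smul, smul_entry, mat_embP, genP_val]
  fin_cases j <;> simp [rmul_entry]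

theorem embQ_smul_genQ (x : Q) : embQ x • genQ = x := by
  ext i j : 2
  rw [Submodule.coe_smul, smul_entry, mat_embQ, genQ_val]
  fin_cases j
  simp [rmul_entry]

theorem span_singleton_eq_top_of_smul_eq_genP {a : A} {x : P} (h : a • x = genP) :
    Submodule.span A {x} = ⊤ := by
  refine eq_top_iff.2 fun y _ => Submodule.mem_span_singleton.2 ⟨embP y * a, ?_⟩
  rw [mul_smul, h, embP_smul_genP]

theorem span_singleton_eq_top_of_smul_eq_genQ {a : A} {x : Q} (h : a • x = genQ) :
    Submodule.span A {x} = ⊤ := by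
  refine eq_top_iff.2 fun y _ => Submodule.mem_span_singleton.2 ⟨embQ y * a, ?_⟩
  rw [mul_smul, h, embQ_smul_genQ]

theorem S_smul_def (a : A) (z : S) : a • z = (toC a * (show ℂ from z) : ℂ) := rfl

theorem T_smul_def (a : A) (z : T) : a • z = (toR a * (show ℝ from z) : ℝ) := rfl

instance : Nontrivial S := inferInstanceAs (Nontrivial ℂ)
instance : Nontrivial T := inferInstanceAs (Nontrivial ℝ)

/-- The projection of `P` onto its top. -/
def topP : P →ₗ[A] S where
  toFun x := residue x.1 0
  map_add' x y := congrFun (map_add residue x.1 y.1) 0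
  map_smul' a x := congrFun (map_smulₛₗ residue a x.1) 0

/-- The projection of `Q` onto its top. -/
def topQ : Q →ₗ[A] T where
  toFun x := ev (x.1 2 0)
  map_add' x y := map_add constantCoeff (x.1 2 0) (y.1 2 0)
  map_smul' a x := by
    obtain ⟨h1, h2⟩ := x.2
    change ev ((a • x.1) 2 0) = ev (mat a 2 2) * ev (x.1 2 0)
    simp only [ev] at *
    simp [smul_entry, h1, h2]

theorem topP_surjective : Function.Surjective topP := by
  intro (z : ℂ)
  obtain ⟨a, rfl⟩ := toC_surjective z
  have hgen : residue genP.1 0 = 1 := by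
    rw [residue_apply, genP_val]
    apply Complex.ext <;> simp
  exact ⟨a • genP, (map_smul topP a genP).trans ((congrArg (toC a * ·) hgen).trans (mul_one _))⟩

theorem topQ_surjective : Function.Surjective topQ := fun z : ℝ =>
  ⟨⟨lastRow fun _ => C z, by constructor <;> simp [ev, lastRow_entry]⟩, constantCoeff_C z⟩

theorem exists_smul_eq_genP {x : P} (hx : topP x ≠ 0) : ∃ a : A, a • x = genP := by
  obtain ⟨h1, h2⟩ := x.2
  simp only [ev] at h1 h2
  set δ : R := x.1 0 0 * x.1 1 1 - x.1 0 1 * x.1 1 0 with hδ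
  have hδ0 : constantCoeff δ ≠ 0 := by
    intro h0
    rw [hδ, map_sub, map_mul, map_mul, ← h1, h2] at h0
    have h3 : constantCoeff (x.1 0 1) = 0 := by nlinarith
    have h4 : constantCoeff (x.1 0 0) = 0 := by nlinarith
    exact hx (Complex.ext h4 (h2.trans (neg_eq_zero.2 h3)))
  have hinv : δ * δ⁻¹ = 1 := PowerSeries.mul_inv_cancel δ hδ0
  let m : Matrix (Fin 3) (Fin 3) R := !![x.1 1 1 * δ⁻¹, - x.1 0 1 * δ⁻¹, 0;
    - x.1 1 0 * δ⁻¹, x.1 0 0 * δ⁻¹, 0; 0, 0, 0]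
  let a : A := ⟨m, by refine ⟨?_, ?_, ?_, ?_⟩ <;> simp [m, ev, h1, h2]⟩
  have hm : mat a = m := rfl
  refine ⟨a, ?_⟩
  ext i j : 2
  rw [Submodule.coe_smul, smul_entry, genP_val, hm]
  fin_cases i <;> fin_cases j <;> simp [m]
  · linear_combination hinv
  · ring
  · ring
  · linear_combination hinv

theorem exists_smul_eq_genQ {x : Q} (hx : topQ x ≠ 0) : ∃ a : A, a • x = genQ := by
  have hx' : constantCoeff (x.1 2 0) ≠ 0 := hx
  refine ⟨single 2 2 (x.1 2 0)⁻¹ (Or.inl rfl), ?_⟩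
  ext i j : 2
  rw [Submodule.coe_smul, single_smul_entry, genQ_val]
  fin_cases j
  fin_cases i <;> simp [PowerSeries.inv_mul_cancel _ hx']

theorem span_singleton_eq_top_of_topP_ne_zero (x : P) (hx : topP x ≠ 0) :
    Submodule.span A {x} = ⊤ :=
  let ⟨_, ha⟩ := exists_smul_eq_genP hx
  span_singleton_eq_top_of_smul_eq_genP ha

theorem span_singleton_eq_top_of_topQ_ne_zero (x : Q) (hx : topQ x ≠ 0) :
    Submodule.span A {x} = ⊤ :=
  let ⟨_, ha⟩ := exists_smul_eq_genQ hx
  span_singleton_eq_top_of_smul_eq_genQ ha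

theorem top_quotient_P {N : Submodule A P} (hN : N ≠ ⊤) :
    IsSimpleModule A (TopOf (P ⧸ N)) ∧ Nonempty (TopOf (P ⧸ N) ≃ₗ[A] S) :=
  let ⟨_, hg, h⟩ := exists_surjective_quotient topP_surjective
    span_singleton_eq_top_of_topP_ne_zero hN
  ⟨isSimpleModule_top hg h, nonempty_top_equiv hg h⟩

theorem top_quotient_Q {N : Submodule A Q} (hN : N ≠ ⊤) :
    IsSimpleModule A (TopOf (Q ⧸ N)) ∧ Nonempty (TopOf (Q ⧸ N) ≃ₗ[A] T) :=
  let ⟨_, hg, h⟩ := exists_surjective_quotient topQ_surjective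
    span_singleton_eq_top_of_topQ_ne_zero hN
  ⟨isSimpleModule_top hg h, nonempty_top_equiv hg h⟩

theorem not_nonempty_S_equiv_T : ¬ Nonempty (S ≃ₗ[A] T) := by
  rintro ⟨φ⟩
  have hS (z : S) : f • z = 0 := by
    have hf : toC f = 0 := Complex.ext (map_zero constantCoeff) (map_zero constantCoeff)
    rw [S_smul_def, hf, zero_mul]
    rfl
  have hT (z : T) : f • z = z := by
    have hf : toR f = 1 := map_one constantCoeff
    rw [T_smul_def, hf, one_mul]
  obtain ⟨z, hz⟩ := exists_ne (0 : T)
  exact hz (by rw [← φ.symm.map_eq_zero_iff, ← hT z, map_smul, hS])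

/-! ### Absolutely cyclic modules as quotients of the projective lattices -/

section AbsolutelyCyclic

variable {M : Type*} [AddCommGroup M] [Module ℝ M] [Module A M] [IsScalarTower ℝ A M]

theorem exists_scalar_smul_eq_zero (M : Type*) [AddCommGroup M] [Module ℝ M] [Module A M]
    [IsScalarTower ℝ A M] [Module.Finite ℝ M] :
    ∃ r : R, r ≠ 0 ∧ ∀ m : M, scalar r • m = 0 := by
  let τ : Module.End ℝ M := Algebra.lsmul ℝ ℝ M (scalar t)
  have hτ : minpoly ℝ τ ≠ 0 := minpoly.ne_zero (Algebra.IsIntegral.isIntegral τ)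
  let Φ : Polynomial ℝ →ₐ[ℝ] Module.End ℝ M :=
    ((Algebra.lsmul ℝ ℝ M).comp scalar).comp (Polynomial.coeToPowerSeries.algHom ℝ)
  have hΦ : Φ = Polynomial.aeval τ := by
    apply Polynomial.algHom_ext
    simp [Φ, τ]
  have hzero : Φ (minpoly ℝ τ) = 0 := by rw [hΦ, minpoly.aeval]
  refine ⟨(minpoly ℝ τ : PowerSeries ℝ), by simpa using hτ, fun m => ?_⟩
  simpa [Φ] using LinearMap.congr_fun hzero m

namespace IsAbsolutelyCyclic

theorem exists_quotient (h : IsAbsolutelyCyclic M) :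
    (∃ N : Submodule A P, N ≠ ⊤ ∧ Nonempty (M ≃ₗ[A] P ⧸ N)) ∨
    (∃ N : Submodule A Q, N ≠ ⊤ ∧ Nonempty (M ≃ₗ[A] Q ⧸ N)) := by
  have := h.finite
  have : Module.Finite A M := Module.Finite.of_restrictScalars_finite ℝ A M
  have hcoatom : IsCoatom (Module.jacobson A M) := isSimpleModule_iff_isCoatom.1 h.simple_top
  obtain ⟨x, -, hx⟩ := SetLike.exists_of_lt hcoatom.lt_top
  have : Nontrivial M := ⟨x, 0, fun h0 => hx (h0 ▸ Submodule.zero_mem _)⟩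
  by_cases hex : e • x ∈ Module.jacobson A M
  · have hfx : f • x ∉ Module.jacobson A M := by
      intro hfx
      apply hx
      rw [← one_smul A x, ← e_add_f, add_smul]
      exact Submodule.add_mem _ hex hfx
    exact .inr <| exists_quotient_equiv_of_generator embQ (x := genQ)
      (by rw [embQ_genQ, ← mul_smul, f_mul_f])
      (span_singleton_eq_top_of_notMem_jacobson hcoatom hfx)
  · exact .inl <| exists_quotient_equiv_of_generator embP (x := genP)
      (by rw [embP_genP, ← mul_smul, e_mul_e])
      (span_singleton_eq_top_of_notMem_jacobson hcoatom hex)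

theorem exists_quotient_of_top_T (h : IsAbsolutelyCyclic M) (hT : Nonempty (TopOf M ≃ₗ[A] T)) :
    ∃ N : Submodule A Q, N ≠ ⊤ ∧ Nonempty (M ≃ₗ[A] Q ⧸ N) := by
  refine h.exists_quotient.resolve_left ?_
  rintro ⟨N, hN, ⟨φ⟩⟩
  obtain ⟨α⟩ := hT
  obtain ⟨β⟩ := nonempty_top_equiv_of_equiv φ
  obtain ⟨γ⟩ := (top_quotient_P hN).2
  exact not_nonempty_S_equiv_T ⟨γ.symm ≪≫ₗ β.symm ≪≫ₗ α⟩

theorem exists_quotient_of_top_S (h : IsAbsolutelyCyclic M) (hS : Nonempty (TopOf M ≃ₗ[A] S)) :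
    ∃ N : Submodule A P, N ≠ ⊤ ∧ Nonempty (M ≃ₗ[A] P ⧸ N) := by
  refine h.exists_quotient.resolve_right ?_
  rintro ⟨N, hN, ⟨φ⟩⟩
  obtain ⟨α⟩ := hS
  obtain ⟨β⟩ := nonempty_top_equiv_of_equiv φ
  obtain ⟨γ⟩ := (top_quotient_Q hN).2
  exact not_nonempty_S_equiv_T ⟨α.symm ≪≫ₗ β ≪≫ₗ γ⟩

theorem top (h : IsAbsolutelyCyclic M) :
    Nonempty (TopOf M ≃ₗ[A] T) ∨ Nonempty (TopOf M ≃ₗ[A] S) := by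
  rcases h.exists_quotient with ⟨N, hN, ⟨φ⟩⟩ | ⟨N, hN, ⟨φ⟩⟩
  · obtain ⟨β⟩ := nonempty_top_equiv_of_equiv φ
    obtain ⟨γ⟩ := (top_quotient_P hN).2
    exact Or.inr ⟨β ≪≫ₗ γ⟩
  · obtain ⟨β⟩ := nonempty_top_equiv_of_equiv φ
    obtain ⟨γ⟩ := (top_quotient_Q hN).2
    exact Or.inl ⟨β ≪≫ₗ γ⟩

end IsAbsolutelyCyclic

end AbsolutelyCyclic

/-! ### The standard lattices and the images of the maps between them -/

section Standard

variable {n m : ℕ}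

theorem residueLattice_le_iff {W W' : Submodule ℂ (Fin n → ℂ)} :
    residueLattice W ≤ residueLattice W' ↔ W ≤ W' := by
  refine ⟨fun h u hu => ?_, Submodule.comap_mono⟩
  obtain ⟨w, rfl⟩ := residue_surjective u
  exact h hu

theorem Q_eq_residueLattice : Q = residueLattice ⊥ := by
  ext x
  rw [mem_residueLattice, Submodule.mem_bot, funext_iff, Fin.forall_fin_one, Complex.ext_iff]
  rfl

theorem L_eq_residueLattice : L = residueLattice ⊤ := rfl

/-- The complex line spanned by `(u, v)`. -/
def line (u v : ℂ) : Submodule ℂ (Fin 2 → ℂ) := Submodule.span ℂ {![u, v]}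

theorem mem_line {u v : ℂ} {w : Fin 2 → ℂ} :
    w ∈ line u v ↔ ∃ z, z * u = w 0 ∧ z * v = w 1 := by
  simp only [line, Submodule.mem_span_singleton, funext_iff, Fin.forall_fin_two]
  rfl

theorem P_eq_residueLattice : P = residueLattice (line 1 Complex.I) := by
  ext x
  simp only [mem_residueLattice, mem_line, mul_one, exists_eq_left]
  simp only [Complex.ext_iff, residue_apply, Complex.mul_I_re, Complex.mul_I_im]
  exact ⟨fun h => ⟨by rw [h.2, neg_neg], h.1⟩, fun h => ⟨h.2, by rw [← h.1, neg_neg]⟩⟩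

theorem mem_dsum {F G : Submodule A (Mat 1)} {x : Mat 2} :
    x ∈ dsum F G ↔ col 0 x ∈ F ∧ col 1 x ∈ G := Iff.rfl

theorem residue_col (j : Fin n) (x : Mat n) (i : Fin 1) : residue (col j x) i = residue x j := rfl

theorem dsum_Q_Q_eq_residueLattice : dsum Q Q = residueLattice ⊥ := by
  ext x
  simp only [mem_dsum, Q_eq_residueLattice, mem_residueLattice, Submodule.mem_bot, funext_iff,
    Fin.forall_fin_one, Fin.forall_fin_two, residue_col, Pi.zero_apply]

theorem dsum_L_L_eq_residueLattice : dsum L L = residueLattice ⊤ := inf_top_eq _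

theorem dsum_L_Q_eq_residueLattice : dsum L Q = residueLattice (line 1 0) := by
  ext x
  simp only [mem_dsum, Q_eq_residueLattice, L_eq_residueLattice, mem_residueLattice,
    Submodule.mem_top, true_and, Submodule.mem_bot, funext_iff, Fin.forall_fin_one, residue_col,
    Pi.zero_apply, mem_line, mul_one, mul_zero, exists_eq_left, eq_comm]

theorem map_range_latticeMap (F : Submodule A (Mat n)) (F' : Submodule A (Mat m))
    (Z : Matrix (Fin n) (Fin m) R) (h : ∀ x ∈ F, rmul Z x ∈ F') :
    (LinearMap.range (latticeMap F F' Z h)).map F'.subtype = F.map (rmul Z) := by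
  rw [← LinearMap.range_comp, ← LinearMap.range_domRestrict]
  rfl

end Standard

/-! ### Last rows -/

section Rows

variable {n : ℕ}

/-- The `R`-lattice of the last rows of the elements of `N`. -/
def rows (N : Submodule A (Mat n)) : Submodule R (Fin n → R) := N.comap lastRow

theorem mem_rows {N : Submodule A (Mat n)} {v : Fin n → R} : v ∈ rows N ↔ lastRow v ∈ N := Iff.rfl

theorem exists_mem_iff_t_pow_dvd {I : Ideal R} (hI : I ≠ ⊥) : ∃ k, ∀ r, r ∈ I ↔ t ^ k ∣ r := by
  obtain ⟨k, hk⟩ := IsDiscreteValuationRing.ideal_eq_span_pow_irreducible hI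
    (PowerSeries.X_prime.irreducible : Irreducible t)
  exact ⟨k, fun r => by rw [hk, Ideal.mem_span_singleton]⟩

theorem exists_forall_smul_mem_rows (W : Submodule ℂ (Fin n → ℂ)) {F : Submodule A (Mat n)}
    (hF : F = residueLattice W) (N : Submodule A F) [Module.Finite ℝ (F ⧸ N)] :
    ∃ r : R, r ≠ 0 ∧ ∀ v, r • v ∈ rows (N.map F.subtype) := by
  obtain ⟨r, hr0, hr⟩ := exists_scalar_smul_eq_zero (F ⧸ N)
  refine ⟨r, hr0, fun v => ?_⟩
  have hv : lastRow v ∈ F := by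
    rw [hF, mem_residueLattice, residue_lastRow]
    exact W.zero_mem
  have hN : scalar r • (⟨lastRow v, hv⟩ : F) ∈ N :=
    (Submodule.Quotient.mk_eq_zero N).1 (hr (Submodule.Quotient.mk ⟨lastRow v, hv⟩))
  rw [mem_rows, map_smulₛₗ]
  exact Submodule.mem_map_of_mem hN

end Rows

/-! ### Modules with top `T` -/

namespace FormT

/-- The exponent of `t` in a map into `Q`. -/
def exponent : FormT → ℕ
  | QQ k _ => k
  | LQ k _ => k

/-- The complex subspace describing the domain of a map into `Q`. -/
def subspace : FormT → Submodule ℂ (Fin 1 → ℂ)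
  | QQ _ _ => ⊥
  | LQ _ _ => ⊤

theorem map_image (p : FormT) :
    p.image.map Q.subtype = diagLattice (fun _ => p.exponent) p.subspace := by
  have hdiag (k : ℕ) : (!![t ^ k] : Matrix (Fin 1) (Fin 1) R) = diag fun _ => k := by
    ext i j : 1
    fin_cases i
    fin_cases j
    simp [diag]
  cases p with
  | QQ k hk =>
    refine (map_range_latticeMap _ _ _ _).trans ?_
    rw [hdiag, Q_eq_residueLattice]
    rfl
  | LQ k hk =>
    refine (map_range_latticeMap _ _ _ _).trans ?_
    rw [hdiag, L_eq_residueLattice]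
    rfl

theorem hasDimVector (p : FormT) : HasDimVector p.Mod p.dimVector := by
  have h (m : ℕ) := HasDimVector.of_map_subtype_eq (m := m) Q_eq_residueLattice p.map_image
  rw [finrank_bot, add_zero, Fin.sum_univ_one] at h
  cases p with
  | QQ k hk => exact h k (congrArg (k + ·) (finrank_bot ℂ _))
  | LQ k hk =>
    refine h (k - 1) ((congrArg (k - 1 + ·) (finrank_top ℂ _)).trans ?_)
    rw [Module.finrank_fin_fun]
    exact Nat.sub_add_cancel hk

theorem image_ne_top (p : FormT) : p.image ≠ ⊤ := by
  refine p.hasDimVector.ne_top fun h => ?_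
  cases p <;> exact Nat.one_le_iff_ne_zero.1 ‹_› (congrArg Prod.snd h)

theorem dimVector_injective : Function.Injective dimVector := by
  intro p q h
  cases p <;> cases q <;> simp only [dimVector, Prod.mk.injEq, QQ.injEq, LQ.injEq] at h ⊢ <;> omega

theorem isAbsolutelyCyclic (p : FormT) : IsAbsolutelyCyclic p.Mod :=
  ⟨p.hasDimVector.finite, (top_quotient_Q p.image_ne_top).1⟩

theorem nonempty_top_equiv (p : FormT) : Nonempty (TopOf p.Mod ≃ₗ[A] T) :=
  (top_quotient_Q p.image_ne_top).2

end FormT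

theorem exists_map_subtype_eq_diagLattice (N : Submodule A Q) [Module.Finite ℝ (Q ⧸ N)] :
    ∃ k W, N.map Q.subtype = diagLattice (fun _ => k) W := by
  obtain ⟨r, hr0, hr⟩ := exists_forall_smul_mem_rows ⊥ Q_eq_residueLattice N
  let ι := LinearMap.toSpanSingleton R (Fin 1 → R) 1
  have hι (v : Fin 1 → R) : ι (v 0) = v := funext (Fin.forall_fin_one.2 (mul_one (v 0)))
  have hI : (rows (N.map Q.subtype)).comap ι ≠ ⊥ :=
    (Submodule.ne_bot_iff _).2 ⟨r, hr 1, hr0⟩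
  obtain ⟨k, hk⟩ := exists_mem_iff_t_pow_dvd hI
  refine ⟨k, exists_eq_diagLattice _ (fun _ => k) fun v => ?_⟩
  rw [Fin.forall_fin_one, ← mem_rows, ← hk, Submodule.mem_comap, hι]

theorem exists_formT_image_eq {N : Submodule A Q} (hN : N ≠ ⊤) [Module.Finite ℝ (Q ⧸ N)] :
    ∃ p : FormT, p.image = N := by
  obtain ⟨k, W, h⟩ := exists_map_subtype_eq_diagLattice N
  have hinj := Submodule.map_injective_of_injective Q.injective_subtype
  have hk : 1 ≤ k := by
    refine Nat.one_le_iff_ne_zero.2 ?_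
    rintro rfl
    rw [← Pi.zero_def, diagLattice_zero] at h
    have hle : W ≤ ⊥ := by
      rw [← residueLattice_le_iff, ← h, ← Q_eq_residueLattice]
      exact Submodule.map_subtype_le _ _
    refine hN (hinj ?_)
    rw [h, le_bot_iff.1 hle, ← Q_eq_residueLattice, Submodule.map_subtype_top]
  have : IsSimpleModule ℂ (Fin 1 → ℂ) :=
    isSimpleModule_iff_finrank_eq_one.2 (Module.finrank_fin_fun ℂ)
  rcases eq_bot_or_eq_top W with rfl | rfl
  · exact ⟨.QQ k hk, hinj ((FormT.map_image _).trans h.symm)⟩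
  · exact ⟨.LQ k hk, hinj ((FormT.map_image _).trans h.symm)⟩

theorem existsUnique_formT {M : Type*} [AddCommGroup M] [Module ℝ M] [Module A M]
    [IsScalarTower ℝ A M] (hM : IsAbsolutelyCyclic M) (hT : Nonempty (TopOf M ≃ₗ[A] T)) :
    ∃! p : FormT, Nonempty (M ≃ₗ[A] p.Mod) := by
  obtain ⟨N, hN, ⟨φ⟩⟩ := hM.exists_quotient_of_top_T hT
  have := hM.finite
  have : Module.Finite ℝ (Q ⧸ N) := .equiv (φ.restrictScalars ℝ)
  obtain ⟨p, rfl⟩ := exists_formT_image_eq hN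
  refine ⟨p, ⟨φ⟩, fun q ⟨ψ⟩ => FormT.dimVector_injective ?_⟩
  exact q.hasDimVector.unique (p.hasDimVector.of_equiv (φ.symm ≪≫ₗ ψ))

/-! ### Automorphisms of `P` -/

/-- The constant part of `Y` has the form `(α, -β; β, α)`, so that right multiplication by `Y` is
an endomorphism of `P`. -/
def IsEndP (Y : Matrix (Fin 2) (Fin 2) R) : Prop :=
  ev (Y 0 0) = ev (Y 1 1) ∧ ev (Y 1 0) = - ev (Y 0 1)

/-- Some automorphism of `P` maps `N` onto `N'`. -/
def RightEquiv (N N' : Submodule A (Mat 2)) : Prop :=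
  ∃ Y : Matrix (Fin 2) (Fin 2) R, IsEndP Y ∧ IsUnit Y ∧ N.map (rmul Y) = N'

theorem rmul_two_entry (Y : Matrix (Fin 2) (Fin 2) R) (x : Mat 2) (i : Fin 3) (j : Fin 2) :
    rmul Y x i j = x i 0 * Y 0 j + x i 1 * Y 1 j := by
  rw [rmul_entry, Fin.sum_univ_two]

theorem isUnit_iff_ev_ne_zero {r : R} : IsUnit r ↔ ev r ≠ 0 := by
  rw [PowerSeries.isUnit_iff_constantCoeff, isUnit_iff_ne_zero]

theorem isEndP_one : IsEndP 1 := by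
  constructor <;> simp [ev]

namespace IsEndP

variable {Y Z : Matrix (Fin 2) (Fin 2) R}

theorem rmul_mem (hY : IsEndP Y) {x : Mat 2} (hx : x ∈ P) : rmul Y x ∈ P := by
  obtain ⟨h1, h2⟩ := hY
  obtain ⟨h3, h4⟩ := hx
  simp only [ev] at h1 h2 h3 h4
  constructor
  · simp [rmul_two_entry, h1, h2, h3, h4]
    ring
  · simp [rmul_two_entry, h1, h2, h3, h4]

theorem mul (hY : IsEndP Y) (hZ : IsEndP Z) : IsEndP (Y * Z) := by
  obtain ⟨h1, h2⟩ := hY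
  obtain ⟨h3, h4⟩ := hZ
  simp only [ev] at h1 h2 h3 h4
  constructor
  · simp [Matrix.mul_apply, h1, h2, h3, h4]
    ring
  · simp [Matrix.mul_apply, h1, h2, h3, h4]

theorem inv (hY : IsEndP Y) : IsEndP Y⁻¹ := by
  obtain ⟨h1, h2⟩ := hY
  simp only [ev] at h1 h2
  rw [Matrix.inv_def, Matrix.adjugate_fin_two]
  constructor <;> simp [ev, h1, h2]

theorem isUnit_iff (hY : IsEndP Y) : IsUnit Y ↔ ev (Y 0 0) ≠ 0 ∨ ev (Y 1 0) ≠ 0 := by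
  have hdet : ev Y.det = ev (Y 0 0) ^ 2 + ev (Y 1 0) ^ 2 := by
    obtain ⟨h1, h2⟩ := hY
    simp only [ev] at h1 h2 ⊢
    rw [Matrix.det_fin_two, map_sub, map_mul, map_mul, ← h1, h2]
    ring
  rw [Matrix.isUnit_iff_isUnit_det, isUnit_iff_ev_ne_zero, hdet, Ne,
    add_eq_zero_iff_of_nonneg (sq_nonneg _) (sq_nonneg _), sq_eq_zero_iff, sq_eq_zero_iff,
    not_and_or]

end IsEndP

namespace RightEquiv

variable {N N' N'' : Submodule A (Mat 2)}

theorem refl (N : Submodule A (Mat 2)) : RightEquiv N N :=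
  ⟨1, isEndP_one, isUnit_one, map_rmul_one N⟩

theorem symm (h : RightEquiv N N') : RightEquiv N' N := by
  obtain ⟨Y, hY, hunit, rfl⟩ := h
  refine ⟨Y⁻¹, hY.inv, Matrix.isUnit_nonsing_inv_iff.2 hunit, ?_⟩
  rw [map_rmul_map_rmul, Matrix.mul_nonsing_inv Y ((Matrix.isUnit_iff_isUnit_det Y).1 hunit),
    map_rmul_one]

theorem trans (h : RightEquiv N N') (h' : RightEquiv N' N'') : RightEquiv N N'' := by
  obtain ⟨Y, hY, hYunit, rfl⟩ := h
  obtain ⟨Z, hZ, hZunit, rfl⟩ := h'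
  exact ⟨Y * Z, hY.mul hZ, hYunit.mul hZunit, (map_rmul_map_rmul _ _ _).symm⟩

theorem le (h : RightEquiv N N') (hN : N ≤ P) : N' ≤ P := by
  obtain ⟨Y, hY, -, rfl⟩ := h
  exact Submodule.map_le_iff_le_comap.2 fun x hx => hY.rmul_mem (hN hx)

theorem nonempty_quotient_equiv {N N' : Submodule A P}
    (h : RightEquiv (N.map P.subtype) (N'.map P.subtype)) : Nonempty ((P ⧸ N) ≃ₗ[A] P ⧸ N') := by
  obtain ⟨Y, hY, hunit, hN⟩ := h
  have hdet := (Matrix.isUnit_iff_isUnit_det Y).1 hunit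
  let φ : P ≃ₗ[A] P := LinearEquiv.ofLinearMap
    (latticeMap P P Y fun _ => hY.rmul_mem) (latticeMap P P Y⁻¹ fun _ => hY.inv.rmul_mem)
    (LinearMap.ext fun x => Subtype.ext <| (rmul_rmul Y⁻¹ Y x.1).trans <| by
      rw [Matrix.nonsing_inv_mul Y hdet, rmul_one]
      rfl)
    (LinearMap.ext fun x => Subtype.ext <| (rmul_rmul Y Y⁻¹ x.1).trans <| by
      rw [Matrix.mul_nonsing_inv Y hdet, rmul_one]
      rfl)
  refine ⟨Submodule.Quotient.equiv N N' φ ?_⟩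
  apply Submodule.map_injective_of_injective P.injective_subtype
  rw [← hN, ← Submodule.map_comp, ← Submodule.map_comp]
  rfl

end RightEquiv

/-- The matrix `(p, -q; q, p)`. -/
def rotation (p q : R) : Matrix (Fin 2) (Fin 2) R := !![p, -q; q, p]

theorem isEndP_rotation (p q : R) : IsEndP (rotation p q) := by
  constructor <;> simp [ev, rotation]

theorem isUnit_rotation {p q : R} (h : ev p ≠ 0 ∨ ev q ≠ 0) : IsUnit (rotation p q) :=
  (isEndP_rotation p q).isUnit_iff.2 h

theorem rightEquiv_rotation (N : Submodule A (Mat 2)) {p q : R} (h : ev p ≠ 0 ∨ ev q ≠ 0) :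
    RightEquiv N (N.map (rmul (rotation p q))) :=
  ⟨_, isEndP_rotation p q, isUnit_rotation h, rfl⟩

/-! ### The normal forms with top `S` -/

theorem map_rmul_mul_diag {n : ℕ} (W : Submodule ℂ (Fin n → ℂ)) {Y : Matrix (Fin n) (Fin n) R}
    (hY : IsUnit Y) (d : Fin n → ℕ) :
    (residueLattice W).map (rmul (Y * diag d)) = diagLattice d (W.map (residueAct Y)) := by
  rw [← map_rmul_map_rmul, map_rmul_residueLattice W hY, diagLattice]

theorem map_residueAct_line (Y : Matrix (Fin 2) (Fin 2) R) (u v : ℂ) :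
    (line u v).map (residueAct Y) =
      line (u * ev (Y 0 0) + v * ev (Y 1 0)) (u * ev (Y 0 1) + v * ev (Y 1 1)) := by
  have h : residueAct Y ![u, v] =
      ![u * ev (Y 0 0) + v * ev (Y 1 0), u * ev (Y 0 1) + v * ev (Y 1 1)] := by
    funext j
    rw [residueAct_apply, Fin.sum_univ_two]
    fin_cases j <;> rfl
  rw [line, Submodule.map_span, Set.image_singleton, h, line]

theorem line_smul {z : ℂ} (hz : z ≠ 0) (u v : ℂ) : line (z * u) (z * v) = line u v := by
  have h : ![z * u, z * v] = z • ![u, v] := by simp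
  rw [line, h, Submodule.span_singleton_smul_eq (IsUnit.mk0 z hz), line]

theorem finrank_line {u v : ℂ} (h : u ≠ 0 ∨ v ≠ 0) : Module.finrank ℂ (line u v) = 1 := by
  refine finrank_span_singleton fun h0 => ?_
  exact h.elim (· (congrFun h0 0)) (· (congrFun h0 1))

namespace FormS

/-- The parameter `k`. -/
def k : FormS → ℕ
  | QQ k _ => k
  | LL k _ _ => k
  | LQ k _ _ => k
  | LQ' k _ _ => k
  | PP k _ _ _ _ => k

/-- The parameter `l`. -/
def l : FormS → ℕ
  | QQ _ l => l
  | LL _ l _ => l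
  | LQ _ l _ => l
  | LQ' _ l _ => l
  | PP _ l _ _ _ => l

/-- The complex subspace which describes the image, once the map is brought by automorphisms of `P`
to the form `diag ![k, k + l]`. -/
def subspace : FormS → Submodule ℂ (Fin 2 → ℂ)
  | QQ _ _ => ⊥
  | LL _ _ _ => ⊤
  | LQ _ _ _ => line 1 0
  | LQ' _ _ _ => line 0 1
  | PP _ _ c _ _ => line 1 (Complex.I * c)

/-- The image of the map with the given parameters, up to an automorphism of `P`. -/
def lattice (p : FormS) : Submodule A (Mat 2) := diagLattice ![p.k, p.k + p.l] p.subspace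

theorem smul_diagonal_eq_diag (k l : ℕ) :
    t ^ k • (!![1, 0; 0, t ^ l] : Matrix (Fin 2) (Fin 2) R) = diag ![k, k + l] := by
  ext i j : 1
  fin_cases i <;> fin_cases j <;> simp [diag, pow_add]

theorem smul_diagonal_mul_rotation (k l : ℕ) :
    t ^ k • (!![t ^ l, 0; 0, 1] : Matrix (Fin 2) (Fin 2) R) * rotation 0 1 =
      rotation 0 1 * diag ![k, k + l] := by
  rw [← smul_diagonal_eq_diag]
  simp [rotation, mul_comm]

theorem smul_diagonal_eq_mul_diag (k l : ℕ) (c : ℝ) :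
    t ^ k • (!![1, 0; 0, C c * t ^ l] : Matrix (Fin 2) (Fin 2) R) =
      !![1, 0; 0, C c] * diag ![k, k + l] := by
  rw [← smul_diagonal_eq_diag]
  simp [mul_left_comm]

theorem rightEquiv_map_image (p : FormS) : RightEquiv (p.image.map P.subtype) p.lattice := by
  suffices h : RightEquiv (p.image.map P.subtype) (diagLattice ![p.k, p.k + p.l] p.subspace) from h
  cases p with
  | QQ k l =>
    convert RightEquiv.refl _ using 1
    refine .trans ?_ (map_range_latticeMap _ _ _ _).symm
    rw [dsum_Q_Q_eq_residueLattice, smul_diagonal_eq_diag]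
    rfl
  | LL k l hk =>
    convert RightEquiv.refl _ using 1
    refine .trans ?_ (map_range_latticeMap _ _ _ _).symm
    rw [dsum_L_L_eq_residueLattice, smul_diagonal_eq_diag]
    rfl
  | LQ k l hk =>
    convert RightEquiv.refl _ using 1
    refine .trans ?_ (map_range_latticeMap _ _ _ _).symm
    rw [dsum_L_Q_eq_residueLattice, smul_diagonal_eq_diag]
    rfl
  | LQ' k l hl =>
    have h01 : ev (0 : R) ≠ 0 ∨ ev (1 : R) ≠ 0 := by simp [ev]
    convert rightEquiv_rotation _ h01 using 1
    refine .trans ?_ (congrArg (Submodule.map _) (map_range_latticeMap _ _ _ _)).symm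
    rw [dsum_L_Q_eq_residueLattice, map_rmul_map_rmul, smul_diagonal_mul_rotation,
      map_rmul_mul_diag _ (isUnit_rotation h01), map_residueAct_line,
      ← line_smul (neg_ne_zero.2 one_ne_zero)]
    simp [rotation, ev, subspace, FormS.k, FormS.l]
  | PP k l c hk hc =>
    have hunit : IsUnit (!![1, 0; 0, C c] : Matrix (Fin 2) (Fin 2) R) := by
      simp [Matrix.isUnit_iff_isUnit_det, hc]
    convert RightEquiv.refl _ using 1
    refine .trans ?_ (map_range_latticeMap _ _ _ _).symm
    rw [P_eq_residueLattice, smul_diagonal_eq_mul_diag, map_rmul_mul_diag _ hunit,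
      map_residueAct_line]
    simp [subspace, ev, FormS.k, FormS.l]

theorem lattice_le (p : FormS) : p.lattice ≤ P :=
  p.rightEquiv_map_image.le (Submodule.map_subtype_le _ _)

theorem hasDimVector (p : FormS) : HasDimVector p.Mod p.dimVector := by
  have hmap : (p.lattice.comap P.subtype).map P.subtype = p.lattice := by
    rw [Submodule.map_comap_subtype, inf_eq_right.2 p.lattice_le]
  obtain ⟨φ⟩ := RightEquiv.nonempty_quotient_equiv (hmap.symm ▸ p.rightEquiv_map_image.symm)
  have h (m : ℕ) (hm : m + Module.finrank ℂ p.subspace = 2 * p.k + p.l + 1) :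
      HasDimVector p.Mod (m, 2 * p.k + p.l) := by
    have hsum : ∑ j, ![p.k, p.k + p.l] j = 2 * p.k + p.l := by
      rw [Fin.sum_univ_two]
      exact (add_assoc _ _ _).symm.trans (congrArg (· + p.l) (two_mul p.k).symm)
    have hline : Module.finrank ℂ (line 1 Complex.I) = 1 := finrank_line (.inl one_ne_zero)
    rw [← hsum, ← hline] at hm
    exact hsum ▸ (HasDimVector.of_map_subtype_eq P_eq_residueLattice hmap hm).of_equiv φ
  cases p with
  | QQ k l => exact h _ (congrArg (2 * k + l + 1 + ·) (finrank_bot ℂ _))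
  | LL k l hk =>
    refine h (2 * k + l - 1) ((congrArg (2 * k + l - 1 + ·) (finrank_top ℂ _)).trans ?_)
    rw [Module.finrank_fin_fun]
    change _ = 2 * k + l + 1
    omega
  | LQ k l hk => exact h _ (congrArg (2 * k + l + ·) (finrank_line (.inl one_ne_zero)))
  | LQ' k l hl => exact h _ (congrArg (2 * k + l + ·) (finrank_line (.inr one_ne_zero)))
  | PP k l c hk hc => exact h _ (congrArg (2 * k + l + ·) (finrank_line (.inl one_ne_zero)))

theorem image_ne_top (p : FormS) : p.image ≠ ⊤ := by
  refine p.hasDimVector.ne_top fun h => ?_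
  cases p <;> simp only [dimVector, Prod.mk_eq_zero] at h <;> omega

theorem isAbsolutelyCyclic (p : FormS) : IsAbsolutelyCyclic p.Mod :=
  ⟨p.hasDimVector.finite, (top_quotient_P p.image_ne_top).1⟩

theorem nonempty_top_equiv (p : FormS) : Nonempty (TopOf p.Mod ≃ₗ[A] S) :=
  (top_quotient_P p.image_ne_top).2

end FormS

/-! ### Isomorphisms between quotients of `P` -/

theorem rmul_castSucc (x y : P) :
    rmul (Matrix.of fun (i j : Fin 2) => y.1 i.castSucc j) x.1 = (embP x • y).1 := by
  ext i j : 1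
  rw [Submodule.coe_smul, smul_entry, mat_embP, rmul_two_entry]
  simp [rmul_entry]

theorem exists_smul_lift_of_equiv {N N' : Submodule A P} (φ : (P ⧸ N) ≃ₗ[A] P ⧸ N') :
    ∃ y : P, ∀ x, φ (N.mkQ x) = N'.mkQ (embP x • y) := by
  obtain ⟨y, hy⟩ := N'.mkQ_surjective (φ (N.mkQ genP))
  refine ⟨y, fun x => ?_⟩
  rw [map_smul, hy, ← map_smul, ← map_smul, embP_smul_genP]

theorem topP_ne_zero_of_forall_mkQ_eq {N N' : Submodule A P} (hN' : N' ≠ ⊤)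
    {φ : (P ⧸ N) ≃ₗ[A] P ⧸ N'} {y : P} (hy : ∀ x, φ (N.mkQ x) = N'.mkQ (embP x • y)) :
    topP y ≠ 0 := by
  intro h0
  obtain ⟨z, hz⟩ := exists_ne (0 : S)
  obtain ⟨w, rfl⟩ := topP_surjective z
  obtain ⟨v, hv⟩ := φ.surjective (N'.mkQ w)
  obtain ⟨x, rfl⟩ := N.mkQ_surjective v
  rw [hy, ← sub_eq_zero, ← map_sub] at hv
  have hmem : embP x • y - w ∈ N' := (Submodule.Quotient.mk_eq_zero _).1 hv
  have hker := le_ker_of_ne_top span_singleton_eq_top_of_topP_ne_zero hN' hmem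
  rw [LinearMap.mem_ker, map_sub, map_smul, h0, smul_zero, zero_sub, neg_eq_zero] at hker
  exact hz hker

theorem nonempty_quotient_equiv_iff {N N' : Submodule A P} (hN' : N' ≠ ⊤) :
    Nonempty ((P ⧸ N) ≃ₗ[A] P ⧸ N') ↔ RightEquiv (N.map P.subtype) (N'.map P.subtype) := by
  refine ⟨fun ⟨φ⟩ => ?_, RightEquiv.nonempty_quotient_equiv⟩
  obtain ⟨y, hy⟩ := exists_smul_lift_of_equiv φ
  have htop := topP_ne_zero_of_forall_mkQ_eq hN' hy
  have hmem (x : P) : x ∈ N ↔ embP x • y ∈ N' := by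
    rw [← Submodule.Quotient.mk_eq_zero N, ← Submodule.Quotient.mk_eq_zero N']
    exact (map_eq_zero_iff φ φ.injective).symm.trans (iff_of_eq (congrArg (· = 0) (hy x)))
  let Y := Matrix.of fun (i j : Fin 2) => y.1 i.castSucc j
  have hY : IsEndP Y := y.2
  have hunit : IsUnit Y := by
    rw [hY.isUnit_iff]
    by_contra! h
    exact htop (Complex.ext h.1 h.2)
  refine ⟨Y, hY, hunit, le_antisymm ?_ ?_⟩
  · rintro _ ⟨_, ⟨x, hx, rfl⟩, rfl⟩
    exact ⟨_, (hmem x).1 hx, (rmul_castSucc x y).symm⟩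
  · rintro _ ⟨x, hx, rfl⟩
    have hinv : rmul Y (rmul Y⁻¹ x.1) = x.1 := by
      rw [rmul_rmul, Matrix.nonsing_inv_mul Y ((Matrix.isUnit_iff_isUnit_det Y).1 hunit), rmul_one]
    let x' : P := ⟨rmul Y⁻¹ x.1, hY.inv.rmul_mem x.2⟩
    have hx' : embP x' • y = x := Subtype.ext ((rmul_castSucc x' y).symm.trans hinv)
    exact ⟨x'.1, ⟨x', (hmem x').2 (hx'.symm ▸ hx), rfl⟩, hinv⟩

/-! ### Diagonal lattices up to automorphisms of `P` -/

theorem t_pow_dvd_t_pow_iff {k m : ℕ} : t ^ k ∣ t ^ m ↔ k ≤ m :=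
  pow_dvd_pow_iff PowerSeries.X_ne_zero PowerSeries.X_prime.not_isUnit

theorem residueAct_congr {n m : ℕ} {Y Z : Matrix (Fin n) (Fin m) R}
    (h : ∀ i j, ev (Y i j) = ev (Z i j)) : residueAct Y = residueAct Z := by
  have hmap : Y.map (fun p => (ev p : ℂ)) = Z.map fun p => (ev p : ℂ) :=
    Matrix.ext fun i j => congrArg Complex.ofReal (h i j)
  rw [residueAct, hmap, residueAct]

theorem map_rmul_diagLattice {n : ℕ} {d : Fin n → ℕ} {Y Z : Matrix (Fin n) (Fin n) R}
    (hZ : IsUnit Z) (h : diag d * Y = Z * diag d) (W : Submodule ℂ (Fin n → ℂ)) :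
    (diagLattice d W).map (rmul Y) = diagLattice d (W.map (residueAct Z)) := by
  rw [diagLattice, map_rmul_map_rmul, h, map_rmul_mul_diag W hZ]

theorem diagLattice_injective {n : ℕ} (d : Fin n → ℕ) : Function.Injective (diagLattice d) := by
  intro W W' h
  ext u
  obtain ⟨w, rfl⟩ := residue_surjective u
  rw [← rmul_diag_mem_diagLattice_iff, h, rmul_diag_mem_diagLattice_iff]

theorem diag_mul_eq_mul_diag (k : ℕ) {l : ℕ} (a b c d : R) :
    diag ![k, k + l] * !![a, t ^ l * b; c, d] = !![a, b; t ^ l * c, d] * diag ![k, k + l] := by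
  ext i j : 1
  rw [diag, Matrix.diagonal_mul, Matrix.mul_diagonal]
  fin_cases i <;> fin_cases j <;> simp <;> ring

namespace RightEquiv

variable {k l k' l' : ℕ} {W W' : Submodule ℂ (Fin 2 → ℂ)}

theorem t_pow_dvd_mul {d' : Fin 2 → ℕ} {Y : Matrix (Fin 2) (Fin 2) R}
    (h : (diagLattice ![k, k + l] W).map (rmul Y) = diagLattice d' W') (j : Fin 2) :
    t ^ d' j ∣ t ^ k * Y 0 j := by
  have hmem : rmul (diag ![k, k + l]) (lastRow ![1, 0]) ∈ diagLattice ![k, k + l] W := by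
    rw [rmul_diag_mem_diagLattice_iff, residue_lastRow]
    exact W.zero_mem
  have hdvd := t_pow_dvd_of_mem_diagLattice (h ▸ Submodule.mem_map_of_mem hmem) 2 j
  rw [rmul_two_entry, rmul_diag_entry, rmul_diag_entry] at hdvd
  simpa [lastRow_entry] using hdvd

theorem exponent_le (h : RightEquiv (diagLattice ![k, k + l] W) (diagLattice ![k', k' + l'] W')) :
    k' ≤ k := by
  obtain ⟨Y, hY, hunit, hmap⟩ := h
  obtain ⟨j, hj⟩ : ∃ j, IsUnit (Y 0 j) := by
    by_contra! h0
    simp only [isUnit_iff_ev_ne_zero, not_not] at h0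
    refine (hY.isUnit_iff.1 hunit).elim (· (h0 0)) (· ?_)
    rw [hY.2, h0 1, neg_zero]
  have hle : ![k', k' + l'] j ≤ k :=
    t_pow_dvd_t_pow_iff.1 (hj.dvd_mul_right.1 (t_pow_dvd_mul hmap j))
  fin_cases j
  · exact hle
  · exact (Nat.le_add_right _ _).trans hle

theorem exists_map_residueAct
    (h : RightEquiv (diagLattice ![k, k + l] W) (diagLattice ![k, k + l] W')) :
    ∃ (Y : Matrix (Fin 2) (Fin 2) R) (y : R), IsEndP Y ∧ IsUnit Y ∧ Y 0 1 = t ^ l * y ∧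
      W.map (residueAct !![Y 0 0, y; t ^ l * Y 1 0, Y 1 1]) = W' := by
  obtain ⟨Y, hY, hunit, hmap⟩ := h
  have hdvd : t ^ (k + l) ∣ t ^ k * Y 0 1 := t_pow_dvd_mul hmap 1
  rw [pow_add, mul_dvd_mul_iff_left (pow_ne_zero k PowerSeries.X_ne_zero)] at hdvd
  obtain ⟨y, hy⟩ := hdvd
  refine ⟨Y, y, hY, hunit, hy, diagLattice_injective _ (hmap ▸ (map_rmul_diagLattice ?_ ?_ W).symm)⟩
  · rw [Matrix.isUnit_iff_isUnit_det, Matrix.det_fin_two] at hunit ⊢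
    rw [hy] at hunit
    convert hunit using 1
    simp only [Matrix.of_apply, Matrix.cons_val_zero, Matrix.cons_val_one]
    ring
  · rw [← diag_mul_eq_mul_diag, ← hy, ← Matrix.eta_fin_two]

end RightEquiv

theorem rightEquiv_diagLattice_zero_iff {k : ℕ} {W W' : Submodule ℂ (Fin 2 → ℂ)} :
    RightEquiv (diagLattice ![k, k + 0] W) (diagLattice ![k, k + 0] W') ↔
      ∃ a b : ℝ, (a ≠ 0 ∨ b ≠ 0) ∧ W.map (residueAct (rotation (C a) (C b))) = W' := by
  constructor
  · intro h
    obtain ⟨Y, y, hY, hunit, hy, hW⟩ := h.exists_map_residueAct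
    rw [pow_zero, one_mul] at hy
    refine ⟨ev (Y 0 0), ev (Y 1 0), hY.isUnit_iff.1 hunit, hW ▸ ?_⟩
    refine congrArg (W.map ·) (residueAct_congr fun i j => ?_)
    obtain ⟨h1, h2⟩ := hY
    simp only [ev, hy] at h1 h2
    fin_cases i <;> fin_cases j <;> simp [rotation, ev, h1, h2]
  · rintro ⟨a, b, hab, rfl⟩
    have hab' : ev (C a : R) ≠ 0 ∨ ev (C b : R) ≠ 0 := by simpa [ev] using hab
    have hcomm := diag_mul_eq_mul_diag (l := 0) k (C a) (-C b) (C b) (C a)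
    rw [pow_zero, one_mul, one_mul] at hcomm
    exact ⟨_, isEndP_rotation _ _, isUnit_rotation hab',
      map_rmul_diagLattice (isUnit_rotation hab') hcomm W⟩

theorem rightEquiv_diagLattice_iff {k l : ℕ} (hl : l ≠ 0) {W W' : Submodule ℂ (Fin 2 → ℂ)} :
    RightEquiv (diagLattice ![k, k + l] W) (diagLattice ![k, k + l] W') ↔
      ∃ a b : ℝ, a ≠ 0 ∧ W.map (residueAct !![C a, C b; 0, C a]) = W' := by
  constructor
  · intro h
    obtain ⟨Y, y, hY, hunit, hy, hW⟩ := h.exists_map_residueAct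
    have h01 : ev (Y 0 1) = 0 := by simp [ev, hy, hl]
    have h10 : ev (Y 1 0) = 0 := by rw [hY.2, h01, neg_zero]
    refine ⟨ev (Y 0 0), ev y, (hY.isUnit_iff.1 hunit).resolve_right (not_not.2 h10), hW ▸ ?_⟩
    refine congrArg (W.map ·) (residueAct_congr fun i j => ?_)
    have h11 := hY.1
    simp only [ev] at h11
    fin_cases i <;> fin_cases j <;> simp [ev, hl, h11]
  · rintro ⟨a, b, ha, rfl⟩
    have hunit : IsUnit (!![C a, C b; 0, C a] : Matrix (Fin 2) (Fin 2) R) := by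
      simp [Matrix.isUnit_iff_isUnit_det, ha]
    have hcomm := diag_mul_eq_mul_diag (l := l) k (C a) (C b) 0 (C a)
    rw [mul_zero] at hcomm
    have hY : IsEndP !![C a, t ^ l * C b; 0, C a] := by
      constructor <;> simp [ev, hl]
    exact ⟨_, hY, hY.isUnit_iff.2 (.inl (by simpa [ev] using ha)),
      map_rmul_diagLattice hunit hcomm W⟩

/-! ### Diagonalising the lattice of last rows -/

theorem rows_map_rmul {n m : ℕ} (N : Submodule A (Mat n)) (Y : Matrix (Fin n) (Fin m) R) :
    rows (N.map (rmul Y)) = (rows N).map Y.vecMulLinear := by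
  ext v
  constructor
  · rintro ⟨x, hx, hv⟩
    refine ⟨x 2, lastRow_mem_of_mem hx 2, ?_⟩
    exact (congrFun hv 2 : rmul Y x 2 = v)
  · rintro ⟨w, hw, rfl⟩
    exact ⟨lastRow w, hw, rmul_lastRow Y w⟩

theorem exists_t_pow_smul_mem {n : ℕ} {V : Submodule R (Fin n → R)} (hV : V ≠ ⊥) :
    ∃ k p, t ^ k • p ∈ V ∧ (∃ j, ev (p j) ≠ 0) ∧ ∀ v ∈ V, ∀ j, t ^ k ∣ v j := by
  let I : Ideal R := ⨆ j, V.map (LinearMap.proj j)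
  have hmem {v} (hv : v ∈ V) (j : Fin n) : v j ∈ I :=
    le_iSup (fun j => V.map (LinearMap.proj j)) j (Submodule.mem_map_of_mem hv)
  have hI : I ≠ ⊥ := by
    obtain ⟨v, hv, hv0⟩ := V.ne_bot_iff.1 hV
    obtain ⟨j, hj⟩ := Function.ne_iff.1 hv0
    exact (Submodule.ne_bot_iff _).2 ⟨v j, hmem hv j, hj⟩
  obtain ⟨k, hk⟩ := exists_mem_iff_t_pow_dvd hI
  obtain ⟨v, hv, j, hj⟩ : ∃ v ∈ V, ∃ j, ¬ t ^ (k + 1) ∣ v j := by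
    by_contra! h
    have hle : I ≤ Ideal.span {t ^ (k + 1)} := iSup_le fun j => Submodule.map_le_iff_le_comap.2
      fun v hv => Ideal.mem_span_singleton.2 (h v hv j)
    have hdvd := Ideal.mem_span_singleton.1 (hle ((hk (t ^ k)).2 dvd_rfl))
    exact k.not_succ_le_self (t_pow_dvd_t_pow_iff.1 hdvd)
  choose p hp using fun i => (hk (v i)).1 (hmem hv i)
  refine ⟨k, p, (funext hp : v = t ^ k • p) ▸ hv, ⟨j, fun h0 => hj ?_⟩,
    fun w hw i => (hk _).1 (hmem hw i)⟩
  rw [hp, pow_succ]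
  exact mul_dvd_mul_left _ (X_dvd_iff.2 h0)

theorem exists_mem_iff_of_t_pow_mem {V : Submodule R (Fin 2 → R)} {k : ℕ} {r : R} (hr0 : r ≠ 0)
    (hr : ![0, r] ∈ V) (hk : ![t ^ k, 0] ∈ V) (hdvd : ∀ v ∈ V, ∀ j, t ^ k ∣ v j) :
    ∃ l, ∀ v, v ∈ V ↔ ∀ j, t ^ ![k, k + l] j ∣ v j := by
  let ι : R →ₗ[R] Fin 2 → R :=
    LinearMap.vecCons 0 (LinearMap.vecCons LinearMap.id LinearMap.vecEmpty)
  obtain ⟨m, hm⟩ := exists_mem_iff_t_pow_dvd (I := V.comap ι)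
    ((Submodule.ne_bot_iff _).2 ⟨r, hr, hr0⟩)
  obtain ⟨l, rfl⟩ : ∃ l, m = k + l :=
    Nat.exists_eq_add_of_le (t_pow_dvd_t_pow_iff.1 (hdvd _ ((hm (t ^ m)).2 dvd_rfl) 1))
  have hiff {v : Fin 2 → R} (h0 : t ^ k ∣ v 0) : v ∈ V ↔ t ^ (k + l) ∣ v 1 := by
    obtain ⟨c, hc⟩ := h0
    have hv : v = c • ![t ^ k, 0] + ι (v 1) := by
      ext1 j
      fin_cases j <;> simp [hc, ι, mul_comm]
    rw [hv, V.add_mem_iff_right (V.smul_mem c hk), ← Submodule.mem_comap, hm]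
    simp [ι]
  refine ⟨l, fun v => ?_⟩
  rw [Fin.forall_fin_two]
  exact ⟨fun h => ⟨hdvd v h 0, (hiff (hdvd v h 0)).1 h⟩, fun h => (hiff h.1).2 h.2⟩

theorem exists_map_rotation {V : Submodule R (Fin 2 → R)} {r : R} (hr0 : r ≠ 0)
    (hr : ∀ v, r • v ∈ V) :
    ∃ p q k l, (ev p ≠ 0 ∨ ev q ≠ 0) ∧
      ∀ v, v ∈ V.map (rotation p q).vecMulLinear ↔ ∀ j, t ^ ![k, k + l] j ∣ v j := by
  have hV : V ≠ ⊥ := V.ne_bot_iff.2 ⟨r • 1, hr 1, smul_ne_zero hr0 one_ne_zero⟩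
  obtain ⟨k, p, hp, hj, hdvd⟩ := exists_t_pow_smul_mem hV
  rw [Fin.exists_fin_two] at hj
  have hunit := isUnit_rotation hj
  have hdet := (Matrix.isUnit_iff_isUnit_det _).1 hunit
  have hvec (v : Fin 2 → R) : (rotation (p 0) (p 1)).vecMulLinear v =
      ![v 0 * p 0 + v 1 * p 1, v 1 * p 0 - v 0 * p 1] := by
    ext1 j
    fin_cases j <;> simp [rotation, Matrix.vecMul, dotProduct]
    ring
  refine ⟨p 0, p 1, k, ?_⟩
  suffices h : ∃ l, ∀ v, v ∈ V.map (rotation (p 0) (p 1)).vecMulLinear ↔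
      ∀ j, t ^ ![k, k + l] j ∣ v j from h.imp fun _ h => ⟨hj, h⟩
  refine exists_mem_iff_of_t_pow_mem hr0 ?_ ?_ ?_
  · refine ⟨r • Matrix.vecMul ![0, 1] (rotation (p 0) (p 1))⁻¹, hr _, ?_⟩
    rw [map_smul, Matrix.vecMulLinear_apply, Matrix.vecMul_vecMul, Matrix.nonsing_inv_mul _ hdet,
      Matrix.vecMul_one]
    simp
  · obtain ⟨δ, hδ⟩ := hdet
    refine ⟨(↑δ⁻¹ : R) • t ^ k • p, V.smul_mem _ hp, ?_⟩
    rw [map_smul, map_smul, hvec]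
    have hδ' : p 0 * p 0 + p 1 * p 1 = δ := by
      rw [hδ, rotation, Matrix.det_fin_two_of]
      ring
    ext1 j
    fin_cases j
    · simp [hδ', mul_comm (t ^ k)]
    · simp [mul_comm]
  · rintro _ ⟨v, hv, rfl⟩
    rw [hvec, Fin.forall_fin_two]
    have h := hdvd v hv
    exact ⟨dvd_add ((h 0).mul_right _) ((h 1).mul_right _),
      dvd_sub ((h 1).mul_right _) ((h 0).mul_right _)⟩

theorem exists_rightEquiv_diagLattice {N : Submodule A (Mat 2)} {r : R} (hr0 : r ≠ 0)
    (hr : ∀ v, r • v ∈ rows N) : ∃ k l W, RightEquiv N (diagLattice ![k, k + l] W) := by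
  obtain ⟨p, q, k, l, hpq, h⟩ := exists_map_rotation hr0 hr
  obtain ⟨W, hW⟩ := exists_eq_diagLattice (N.map (rmul (rotation p q))) ![k, k + l] fun v => by
    rw [← h, ← rows_map_rmul, mem_rows]
  exact ⟨k, l, W, hW ▸ rightEquiv_rotation N hpq⟩

/-! ### Normalising complex subspaces -/

theorem eq_bot_or_eq_top_or_eq_line (W : Submodule ℂ (Fin 2 → ℂ)) :
    W = ⊥ ∨ W = ⊤ ∨ ∃ u v, (u ≠ 0 ∨ v ≠ 0) ∧ W = line u v := by
  by_cases hbot : W = ⊥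
  · exact .inl hbot
  by_cases htop : W = ⊤
  · exact .inr (.inl htop)
  refine .inr (.inr ?_)
  obtain ⟨w, hw, hw0⟩ := W.ne_bot_iff.1 hbot
  have hw' : w 0 ≠ 0 ∨ w 1 ≠ 0 := by
    rw [Function.ne_iff, Fin.exists_fin_two] at hw0
    exact hw0
  have hline : line (w 0) (w 1) ≤ W := by
    have hw_eta : ![w 0, w 1] = w := funext (Fin.forall_fin_two.2 ⟨rfl, rfl⟩)
    rwa [line, Submodule.span_singleton_le_iff_mem, hw_eta]
  refine ⟨w 0, w 1, hw', (Submodule.eq_of_le_of_finrank_le hline ?_).symm⟩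
  rw [finrank_line hw']
  have hlt := Submodule.finrank_lt htop
  rw [Module.finrank_fin_fun] at hlt
  exact Nat.lt_succ_iff.1 hlt

theorem exists_sq_mul_eq_ofReal (w : ℂ) : ∃ z : ℂ, z ≠ 0 ∧ ∃ r : ℝ, 0 ≤ r ∧ z ^ 2 * w = r := by
  by_cases hw : w = 0
  · exact ⟨1, one_ne_zero, 0, le_rfl, by simp [hw]⟩
  · obtain ⟨z, hz⟩ := IsAlgClosed.exists_pow_nat_eq (starRingEnd ℂ w) two_pos
    refine ⟨z, ?_, Complex.normSq w, Complex.normSq_nonneg w, ?_⟩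
    · rintro rfl
      exact hw (star_eq_zero.1 (hz.symm.trans (zero_pow two_ne_zero)))
    · rw [hz, mul_comm, Complex.mul_conj]

theorem map_rotation_line_re {u v : ℂ} (hre : u.re ≠ 0 ∨ v.re ≠ 0)
    (h : u.re * u.im + v.re * v.im = 0) :
    (line u v).map (residueAct (rotation (C u.re) (C v.re))) =
      line 1 (Complex.I * ↑((v.im * u.re - u.im * v.re) / (u.re ^ 2 + v.re ^ 2))) := by
  have hpos : 0 < u.re ^ 2 + v.re ^ 2 := by
    rcases hre with h | h <;> positivity
  have hne : ((u.re ^ 2 + v.re ^ 2 : ℝ) : ℂ) ≠ 0 := Complex.ofReal_ne_zero.2 hpos.ne'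
  rw [map_residueAct_line, ← line_smul hne 1, mul_left_comm, ← Complex.ofReal_mul,
    mul_div_cancel₀ _ hpos.ne']
  congr 1
  · apply Complex.ext <;> simp [rotation, ev, pow_two]
    linarith
  · apply Complex.ext <;> simp [rotation, ev] <;> ring

-- `u ^ 2 + v ^ 2` is real and nonnegative iff the real and imaginary parts of `(u, v)` are
-- orthogonal and the real part is at least as long, so one rotation aligns both with the axes.
theorem exists_map_rotation_line_of_sq_add_sq {u v : ℂ} (huv : u ≠ 0 ∨ v ≠ 0) {r : ℝ} (hr : 0 ≤ r)
    (h : u ^ 2 + v ^ 2 = r) :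
    ∃ a b : ℝ, (a ≠ 0 ∨ b ≠ 0) ∧ ∃ c ∈ Set.Icc (-1 : ℝ) 1,
      (line u v).map (residueAct (rotation (C a) (C b))) = line 1 (Complex.I * c) := by
  obtain ⟨hre, him⟩ := Complex.ext_iff.1 h
  simp only [Complex.add_re, Complex.add_im, pow_two, Complex.mul_re, Complex.mul_im,
    Complex.ofReal_re, Complex.ofReal_im] at hre him
  have horth : u.re * u.im + v.re * v.im = 0 := by linarith
  have hne : u.re ≠ 0 ∨ v.re ≠ 0 := by
    by_contra! h0
    rw [h0.1, h0.2] at hre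
    have hu : u.im = 0 := by nlinarith
    have hv : v.im = 0 := by nlinarith
    exact huv.elim (· (Complex.ext h0.1 hu)) (· (Complex.ext h0.2 hv))
  refine ⟨u.re, v.re, hne, _, ?_, map_rotation_line_re hne horth⟩
  have hpos : 0 < u.re ^ 2 + v.re ^ 2 := by
    rcases hne with h | h <;> positivity
  rw [Set.mem_Icc, ← abs_le, abs_div, abs_of_pos hpos, div_le_one hpos, ← abs_of_pos hpos,
    ← sq_le_sq]
  nlinarith [sq_nonneg (u.re * u.im + v.re * v.im)]

theorem exists_map_rotation_line {u v : ℂ} (huv : u ≠ 0 ∨ v ≠ 0) :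
    ∃ a b : ℝ, (a ≠ 0 ∨ b ≠ 0) ∧ ∃ c ∈ Set.Icc (-1 : ℝ) 1,
      (line u v).map (residueAct (rotation (C a) (C b))) = line 1 (Complex.I * c) := by
  obtain ⟨z, hz, r, hr, h⟩ := exists_sq_mul_eq_ofReal (u ^ 2 + v ^ 2)
  rw [← line_smul hz]
  refine exists_map_rotation_line_of_sq_add_sq ?_ hr (by rw [← h]; ring)
  exact huv.imp (mul_ne_zero hz) (mul_ne_zero hz)

theorem rightEquiv_line_imaginary {k l : ℕ} (hl : l ≠ 0) (z : ℂ) :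
    RightEquiv (diagLattice ![k, k + l] (line 1 z))
      (diagLattice ![k, k + l] (line 1 (Complex.I * z.im))) := by
  refine (rightEquiv_diagLattice_iff hl).2 ⟨1, -z.re, one_ne_zero, ?_⟩
  rw [map_residueAct_line]
  congr 1
  · simp [ev]
  · apply Complex.ext <;> simp [ev]

/-! ### Modules with top `S` -/

section Existence

variable {k l : ℕ}

theorem re_mul_zero_pow_eq_im_mul_zero_pow {W : Submodule ℂ (Fin 2 → ℂ)}
    (hle : diagLattice ![k, k + l] W ≤ P) {w : Fin 2 → ℂ} (hw : w ∈ W) :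
    (w 0).re * 0 ^ k = (w 1).im * 0 ^ (k + l) := by
  obtain ⟨x, rfl⟩ := residue_surjective w
  have h := (hle (rmul_diag_mem_diagLattice_iff.2 hw)).1
  rw [rmul_diag_entry, rmul_diag_entry] at h
  simpa [ev, residue_apply] using h

theorem exists_formS_lattice_eq_imaginary {c : ℝ}
    (hle : diagLattice ![k, k + l] (line 1 (Complex.I * c)) ≤ P)
    (hne : diagLattice ![k, k + l] (line 1 (Complex.I * c)) ≠ P)
    (hc : l = 0 → c ∈ Set.Icc (-1 : ℝ) 1) :
    ∃ p : FormS, p.IsNormalized ∧ diagLattice ![k, k + l] (line 1 (Complex.I * c)) = p.lattice := by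
  have hk : 1 ≤ k := by
    refine Nat.one_le_iff_ne_zero.2 fun hk => hne ?_
    subst hk
    have h := re_mul_zero_pow_eq_im_mul_zero_pow hle (Submodule.mem_span_singleton_self _)
    obtain rfl : l = 0 := by
      by_contra hl
      simp [hl] at h
    obtain rfl : 1 = c := by simpa using h
    rw [Complex.ofReal_one, mul_one, P_eq_residueLattice, ← diagLattice_zero]
    congr 1
    ext j
    fin_cases j <;> rfl
  by_cases hc0 : c = 0
  · subst hc0
    refine ⟨.LQ k l hk, trivial, ?_⟩
    rw [Complex.ofReal_zero, mul_zero]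
    rfl
  · exact ⟨.PP k l c hk hc0, hc, rfl⟩

theorem exists_formS_rightEquiv_of_line {u v : ℂ} (huv : u ≠ 0 ∨ v ≠ 0)
    (hle : diagLattice ![k, k + l] (line u v) ≤ P)
    (hne : ¬ RightEquiv (diagLattice ![k, k + l] (line u v)) P) :
    ∃ p : FormS, p.IsNormalized ∧ RightEquiv (diagLattice ![k, k + l] (line u v)) p.lattice := by
  have himaginary {c : ℝ} (hc : l = 0 → c ∈ Set.Icc (-1 : ℝ) 1)
      (h : RightEquiv (diagLattice ![k, k + l] (line u v))
        (diagLattice ![k, k + l] (line 1 (Complex.I * c)))) :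
      ∃ p : FormS, p.IsNormalized ∧
        RightEquiv (diagLattice ![k, k + l] (line u v)) p.lattice := by
    obtain ⟨p, hp, hpD⟩ := exists_formS_lattice_eq_imaginary (h.le hle) (fun hP => hne (hP ▸ h)) hc
    exact ⟨p, hp, hpD ▸ h⟩
  rcases eq_or_ne l 0 with rfl | hl
  · obtain ⟨a, b, hab, c, hc, h⟩ := exists_map_rotation_line huv
    exact himaginary (fun _ => hc) (rightEquiv_diagLattice_zero_iff.2 ⟨a, b, hab, h⟩)
  · by_cases hu : u = 0
    · subst hu
      have hv : v ≠ 0 := huv.resolve_left (not_not.2 rfl)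
      refine ⟨.LQ' k l (Nat.one_le_iff_ne_zero.2 hl), trivial, ?_⟩
      convert RightEquiv.refl _ using 1
      rw [← line_smul (inv_ne_zero hv), mul_zero, inv_mul_cancel₀ hv]
      rfl
    · refine himaginary (fun h => absurd h hl) ?_ (c := (u⁻¹ * v).im)
      rw [← line_smul (inv_ne_zero hu), inv_mul_cancel₀ hu]
      exact rightEquiv_line_imaginary hl _

theorem exists_formS_rightEquiv {W : Submodule ℂ (Fin 2 → ℂ)} (hle : diagLattice ![k, k + l] W ≤ P)
    (hne : ¬ RightEquiv (diagLattice ![k, k + l] W) P) :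
    ∃ p : FormS, p.IsNormalized ∧ RightEquiv (diagLattice ![k, k + l] W) p.lattice := by
  rcases eq_bot_or_eq_top_or_eq_line W with rfl | rfl | ⟨u, v, huv, rfl⟩
  · exact ⟨.QQ k l, trivial, .refl _⟩
  · have hk : 1 ≤ k := by
      refine Nat.one_le_iff_ne_zero.2 fun hk => ?_
      have h := re_mul_zero_pow_eq_im_mul_zero_pow hle (Submodule.mem_top (x := ![1, 0]))
      simp [hk] at h
    exact ⟨.LL k l hk, trivial, .refl _⟩
  · exact exists_formS_rightEquiv_of_line huv hle hne

theorem exists_formS {N : Submodule A P} (hN : N ≠ ⊤) [Module.Finite ℝ (P ⧸ N)] :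
    ∃ p : FormS, p.IsNormalized ∧ Nonempty ((P ⧸ N) ≃ₗ[A] p.Mod) := by
  obtain ⟨r, hr0, hr⟩ := exists_forall_smul_mem_rows _ P_eq_residueLattice N
  obtain ⟨k, l, W, hW⟩ := exists_rightEquiv_diagLattice hr0 hr
  have hne : ¬ RightEquiv (diagLattice ![k, k + l] W) P := by
    intro hP
    have htop : RightEquiv (N.map P.subtype) ((⊤ : Submodule A P).map P.subtype) :=
      (Submodule.map_subtype_top P).symm ▸ hW.trans hP
    obtain ⟨φ⟩ := htop.nonempty_quotient_equiv
    have := φ.toEquiv.subsingleton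
    exact hN (Submodule.Quotient.subsingleton_iff.1 this)
  obtain ⟨p, hp, h⟩ := exists_formS_rightEquiv (hW.le (Submodule.map_subtype_le _ _)) hne
  exact ⟨p, hp, ((hW.trans h).trans p.rightEquiv_map_image.symm).nonempty_quotient_equiv⟩

end Existence

/-! ### Uniqueness of the normal forms with top `S` -/

section Uniqueness

variable {k l : ℕ}

theorem line_eq_line_one_iff {u v z : ℂ} : line u v = line 1 z ↔ u ≠ 0 ∧ v = u * z := by
  constructor
  · intro h
    obtain ⟨s, hs, -⟩ := mem_line.1 (h ▸ Submodule.mem_span_singleton_self _ : ![1, z] ∈ line u v)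
    obtain ⟨r, hr, hv⟩ := mem_line.1 (h ▸ Submodule.mem_span_singleton_self _ : ![u, v] ∈ line 1 z)
    rw [mul_one] at hr
    exact ⟨right_ne_zero_of_mul (hs.trans_ne one_ne_zero), hv.symm.trans (congrArg (· * z) hr)⟩
  · rintro ⟨hu, rfl⟩
    rw [← line_smul hu 1, mul_one]

theorem rightEquiv_line_imaginary_iff {c c' : ℝ} :
    RightEquiv (diagLattice ![k, k + l] (line 1 (Complex.I * c)))
      (diagLattice ![k, k + l] (line 1 (Complex.I * c'))) ↔ c' = c ∨ l = 0 ∧ c * c' = 1 := by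
  rcases eq_or_ne l 0 with rfl | hl
  · rw [rightEquiv_diagLattice_zero_iff]
    simp only [map_residueAct_line, line_eq_line_one_iff]
    constructor
    · rintro ⟨a, b, hab, -, h⟩
      have hre : b = c * b * c' := by simpa [rotation, ev] using congrArg Complex.re h
      have him : c * a = a * c' := by simpa [rotation, ev] using congrArg Complex.im h
      rcases hab with ha | hb
      · exact .inl (mul_left_cancel₀ ha (by linarith))
      · exact .inr ⟨trivial, mul_left_cancel₀ hb (by linarith)⟩
    · rintro (rfl | ⟨-, h⟩)
      · exact ⟨1, 0, .inl one_ne_zero, by simp [rotation, ev]⟩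
      · have hc : c ≠ 0 := left_ne_zero_of_mul (h.trans_ne one_ne_zero)
        refine ⟨0, 1, .inr one_ne_zero, by simp [rotation, ev, hc], ?_⟩
        apply Complex.ext <;> simp [rotation, ev, h]
  · rw [rightEquiv_diagLattice_iff hl]
    simp only [map_residueAct_line, line_eq_line_one_iff, hl, false_and, or_false]
    constructor
    · rintro ⟨a, b, ha, -, h⟩
      have him : c * a = a * c' := by simpa [ev] using congrArg Complex.im h
      exact mul_left_cancel₀ ha (by linarith)
    · rintro rfl
      exact ⟨1, 0, one_ne_zero, by simp [ev]⟩

theorem not_rightEquiv_line_zero_one (hl : 1 ≤ l) (z : ℂ) :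
    ¬ RightEquiv (diagLattice ![k, k + l] (line 0 1)) (diagLattice ![k, k + l] (line 1 z)) := by
  rw [rightEquiv_diagLattice_iff (Nat.one_le_iff_ne_zero.1 hl)]
  rintro ⟨a, b, -, h⟩
  rw [map_residueAct_line, line_eq_line_one_iff] at h
  exact h.1 (by simp [ev])

theorem not_rightEquiv_line_one_zero {c : ℝ} (hc : c ≠ 0) :
    ¬ RightEquiv (diagLattice ![k, k + l] (line 1 0))
      (diagLattice ![k, k + l] (line 1 (Complex.I * c))) := by
  have h0 : (0 : ℂ) = Complex.I * (0 : ℝ) := by simp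
  rw [h0, rightEquiv_line_imaginary_iff]
  simp [hc]

namespace FormS

theorem nonempty_equiv_iff (p q : FormS) :
    Nonempty (p.Mod ≃ₗ[A] q.Mod) ↔ RightEquiv p.lattice q.lattice :=
  (nonempty_quotient_equiv_iff q.image_ne_top).trans
    ⟨fun h => (p.rightEquiv_map_image.symm.trans h).trans q.rightEquiv_map_image,
      fun h => (p.rightEquiv_map_image.trans h).trans q.rightEquiv_map_image.symm⟩

theorem dimVector_eq_of_equiv {p q : FormS} (φ : p.Mod ≃ₗ[A] q.Mod) :
    p.dimVector = q.dimVector :=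
  (p.hasDimVector.of_equiv φ).unique q.hasDimVector

theorem dimVector_snd (p : FormS) : p.dimVector.2 = 2 * p.k + p.l := by
  cases p <;> rfl

theorem k_eq_of_rightEquiv {p q : FormS} (h : RightEquiv p.lattice q.lattice) : p.k = q.k :=
  le_antisymm h.symm.exponent_le h.exponent_le

theorem l_eq_of_rightEquiv {p q : FormS} (h : RightEquiv p.lattice q.lattice) : p.l = q.l := by
  obtain ⟨φ⟩ := (nonempty_equiv_iff p q).2 h
  have hdim := congrArg Prod.snd (dimVector_eq_of_equiv φ)
  rw [dimVector_snd, dimVector_snd, k_eq_of_rightEquiv h] at hdim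
  exact Nat.add_left_cancel hdim

theorem eq_of_equiv_of_isNormalized {p q : FormS} (hp : p.IsNormalized) (hq : q.IsNormalized)
    (φ : p.Mod ≃ₗ[A] q.Mod) : p = q := by
  have h := (nonempty_equiv_iff p q).1 ⟨φ⟩
  have hdim := dimVector_eq_of_equiv φ
  have hk : p.k = q.k := k_eq_of_rightEquiv h
  have hl : p.l = q.l := l_eq_of_rightEquiv h
  cases p <;> cases q <;> cases hk <;> cases hl <;>
    simp only [dimVector, Prod.mk.injEq, and_true] at hdim <;> try omega
  case QQ.QQ | LL.LL | LQ.LQ | LQ'.LQ' => rfl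
  case LQ.LQ' hl => exact (not_rightEquiv_line_zero_one hl _ h.symm).elim
  case PP.LQ' hl => exact (not_rightEquiv_line_zero_one hl _ h.symm).elim
  case LQ'.LQ hl _ => exact (not_rightEquiv_line_zero_one hl _ h).elim
  case LQ'.PP hl _ _ _ => exact (not_rightEquiv_line_zero_one hl _ h).elim
  case LQ.PP hc _ => exact (not_rightEquiv_line_one_zero hc h).elim
  case PP.LQ hc _ => exact (not_rightEquiv_line_one_zero hc h.symm).elim
  case PP.PP c _ _ c' _ _ =>
    obtain rfl : c' = c := by
      refine (rightEquiv_line_imaginary_iff.1 h).elim id fun ⟨hl0, hmul⟩ => ?_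
      have hcc := hp hl0
      have hcc' := hq hl0
      rw [Set.mem_Icc, ← abs_le, ← sq_le_one_iff_abs_le_one] at hcc hcc'
      exact sub_eq_zero.1 (pow_eq_zero_iff two_ne_zero |>.1
        (le_antisymm (by linarith [hmul, sub_sq c' c]) (sq_nonneg _)))
    rfl

theorem nonempty_PP_equiv_iff (k l k' l' : ℕ) (c c' : ℝ) (hk : 1 ≤ k) (hk' : 1 ≤ k') (hc : c ≠ 0)
    (hc' : c' ≠ 0) : Nonempty ((PP k l c hk hc).Mod ≃ₗ[A] (PP k' l' c' hk' hc').Mod) ↔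
      k' = k ∧ l' = l ∧ (c' = c ∨ (l = 0 ∧ c' = c⁻¹)) := by
  rw [nonempty_equiv_iff, ← mul_eq_one_iff_eq_inv₀ hc, mul_comm c' c]
  constructor
  · intro h
    obtain rfl : k = k' := k_eq_of_rightEquiv h
    obtain rfl : l = l' := l_eq_of_rightEquiv h
    exact ⟨rfl, rfl, rightEquiv_line_imaginary_iff.1 h⟩
  · rintro ⟨rfl, rfl, h⟩
    exact rightEquiv_line_imaginary_iff.2 h

end FormS

end Uniqueness

theorem existsUnique_formS {M : Type*} [AddCommGroup M] [Module ℝ M] [Module A M]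
    [IsScalarTower ℝ A M] (hM : IsAbsolutelyCyclic M) (hS : Nonempty (TopOf M ≃ₗ[A] S)) :
    ∃! p : FormS, p.IsNormalized ∧ Nonempty (M ≃ₗ[A] p.Mod) := by
  obtain ⟨N, hN, ⟨φ⟩⟩ := hM.exists_quotient_of_top_S hS
  have := hM.finite
  have : Module.Finite ℝ (P ⧸ N) := .equiv (φ.restrictScalars ℝ)
  obtain ⟨p, hp, ⟨ψ⟩⟩ := exists_formS hN
  refine ⟨p, ⟨hp, ⟨φ ≪≫ₗ ψ⟩⟩, ?_⟩
  rintro q ⟨hq, ⟨χ⟩⟩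
  exact FormS.eq_of_equiv_of_isNormalized hq hp (χ.symm ≪≫ₗ φ ≪≫ₗ ψ)

end RealGelfand

end

open RealGelfand in
theorem theoremT :
    -- every absolutely cyclic module has top isomorphic to `T` or to `S`
    (∀ (M : Type*) [AddCommGroup M] [Module ℝ M] [Module A M] [IsScalarTower ℝ A M],
      IsAbsolutelyCyclic M →
        Nonempty (TopOf M ≃ₗ[A] T) ∨ Nonempty (TopOf M ≃ₗ[A] S)) ∧
    -- top `T`: exactly one normal form
    (∀ (M : Type*) [AddCommGroup M] [Module ℝ M] [Module A M] [IsScalarTower ℝ A M],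
      IsAbsolutelyCyclic M → Nonempty (TopOf M ≃ₗ[A] T) →
        ∃! p : FormT, Nonempty (M ≃ₗ[A] p.Mod)) ∧
    (∀ p : FormT, IsAbsolutelyCyclic p.Mod ∧ Nonempty (TopOf p.Mod ≃ₗ[A] T) ∧
      HasDimVector p.Mod p.dimVector) ∧
    -- top `S`: exactly one normal form with normalised real parameter
    (∀ (M : Type*) [AddCommGroup M] [Module ℝ M] [Module A M] [IsScalarTower ℝ A M],
      IsAbsolutelyCyclic M → Nonempty (TopOf M ≃ₗ[A] S) →
        ∃! p : FormS, p.IsNormalized ∧ Nonempty (M ≃ₗ[A] p.Mod)) ∧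
    (∀ p : FormS, IsAbsolutelyCyclic p.Mod ∧ Nonempty (TopOf p.Mod ≃ₗ[A] S) ∧
      HasDimVector p.Mod p.dimVector) ∧
    -- the isomorphisms between the modules of the family with a real parameter
    (∀ (k l k' l' : ℕ) (c c' : ℝ) (hk : 1 ≤ k) (hk' : 1 ≤ k') (hc : c ≠ 0) (hc' : c' ≠ 0),
      Nonempty ((FormS.PP k l c hk hc).Mod ≃ₗ[A] (FormS.PP k' l' c' hk' hc').Mod) ↔
        k' = k ∧ l' = l ∧ (c' = c ∨ (l = 0 ∧ c' = c⁻¹))) := by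
  refine ⟨fun M _ _ _ _ hM => hM.top, fun M _ _ _ _ hM hT => existsUnique_formT hM hT,
    fun p => ⟨p.isAbsolutelyCyclic, p.nonempty_top_equiv, p.hasDimVector⟩,
    fun M _ _ _ _ hM hS => existsUnique_formS hM hS,
    fun p => ⟨p.isAbsolutelyCyclic, p.nonempty_top_equiv, p.hasDimVector⟩,
    FormS.nonempty_PP_equiv_iff⟩
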